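/- Let $a<b$, let $k\ge 1$ be an integer, and let $M_1,M_2\in\mathbb R$. There are constants $C_0,C_1$, depending only on $a,b,k,M_1,M_2$, such that the following holds. Let $T>0$ and let $u$ be a smooth solution on $[a,b]\times[0,T]$ of $u_t=-u_{xxxx}$ with periodic boundary conditions (that is, $u$ is the restriction of a function on $\mathbb R\times[0,T]$ that is $C^\infty$ and $(b-a)$-periodic in $x$) and with $u(x,0)=u_0(x)$. Suppose that $$\sup_{t\in[0,T]}|u_t(\cdot,t)|_{k+1}\le M_1,\qquad \sup_{t\in[0,T]}|u(\cdot,t)|_{k+3}\le M_2,$$ where $|w|_m=\|\partial_x^m w\|_{L^2(a,b)}$. Let $a=x_{1/2}<x_{3/2}<\dots<x_{N+1/2}=b$ be a partition into $N\ge 1$ cells $I_j=[x_{j-1/2},x_{j+1/2}]$, let $h=\max_j(x_{j+1/2}-x_{j-1/2})$, and let $V_h^k$ be the space of functions whose restriction to each $I_j$ is a polynomial of degree at most $k$. If $k=1$, assume that all cells have the same length; if $k\ge 2$, the partition is arbitrary. Let $u_h(\cdot,t),q_h(\cdot,t)\in V_h^k$, $0\le t\le T$, with $u_h$ differentiable in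 $t$, solve the semi-discrete mixed discontinuous Galerkin scheme: for all $\phi,\psi\in V_h^k$, all $j=1,\dots,N$ and all $t\in[0,T]$, $$\int_{I_j}u_{ht}\,\phi\,dx=-\int_{I_j}q_{hx}\phi_x\,dx+\{q_{hx}\}\phi\big|_{\partial I_j}+(q_h-\{q_h\})\phi_x\big|_{\partial I_j},$$ $$\int_{I_j}q_h\,\psi\,dx=\int_{I_j}u_{hx}\psi_x\,dx-\{u_{hx}\}\psi\big|_{\partial I_j}-(u_h-\{u_h\})\psi_x\big|_{\partial I_j}.$$ Here $v|_{\partial I_j}=v^-_{j+1/2}-v^+_{j-1/2}$, where $v^\pm$ are the one-sided limits, and $\{v\}=\tfrac12(v^-+v^+)$ at each interface, with $\{v\}_{1/2}=\{v\}_{N+1/2}=\tfrac12(v^+_{1/2}+v^-_{N+1/2})$. Let the initial value $u_h(\cdot,0)$ be the piecewise $L^2$ projection of $u_0$: $\int_{I_j}(u_0-u_h(\cdot,0))\phi\,dx=0$ for all polynomials $\phi$ of degree at most $k$ and all $j$. Then $$\|u_h(\cdot,t)-u(\cdot,t)\|_{L^2(a,b)}\le (C_0+C_1T)\,h^{k+1},\qquad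 0\le t\le T.$$ -/

import Mathlib

open Polynomial

noncomputable section

namespace MixedDG

/-- A partition `a = x_{1/2} < x_{3/2} < ⋯ < x_{N+1/2} = b` of `[a, b]` into `N` cells; the cell
with index `j : Fin N` is `[x j.castSucc, x j.succ]`. -/
structure Mesh (a b : ℝ) where
  N : ℕ
  x : Fin (N + 1) → ℝ
  strictMono : StrictMono x
  first : x 0 = a
  last : x (Fin.last N) = b

namespace Mesh

variable {a b : ℝ} (M : Mesh a b)

/-- Left end point `x_{j-1/2}` of the cell `I_j`. -/
def left (j : Fin M.N) : ℝ := M.x j.castSucc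

/-- Right end point `x_{j+1/2}` of the cell `I_j`. -/
def right (j : Fin M.N) : ℝ := M.x j.succ

/-- Size `h_j` of the cell `I_j`. -/
def cellSize (j : Fin M.N) : ℝ := M.right j - M.left j

/-- Mesh size `h = max_j h_j`. -/
def meshSize : ℝ := ⨆ j : Fin M.N, M.cellSize j

/-- All cells have the same size. -/
def IsUniform : Prop := ∀ i j : Fin M.N, M.cellSize i = M.cellSize j

/-- The cell to the right of `I_j`, cyclically (the first cell if `I_j` is the last one). -/
def next (j : Fin M.N) : Fin M.N := finRotate M.N j

/-- The cell to the left of `I_j`, cyclically (the last cell if `I_j` is the first one). -/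
def prev (j : Fin M.N) : Fin M.N := (finRotate M.N).symm j

/-- The space `V_h^k` of piecewise polynomials of degree at most `k`. An element is given by its
polynomial on each cell, so that one-sided values at the cell interfaces are values of these
polynomials. -/
def dgSpace (k : ℕ) : Submodule ℝ (Fin M.N → ℝ[X]) :=
  Submodule.pi Set.univ fun _ => degreeLE ℝ (k : WithBot ℕ)

/-- The piecewise derivative `v_x`. -/
def dx (v : Fin M.N → ℝ[X]) : Fin M.N → ℝ[X] := fun j => derivative (v j)

/-- The trace `v^-` at the right end point of `I_j`, taken from `I_j`. -/
def inRight (v : Fin M.N → ℝ[X]) (j : Fin M.N) : ℝ := (v j).eval (M.right j)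

/-- The trace `v^+` at the left end point of `I_j`, taken from `I_j`. -/
def inLeft (v : Fin M.N → ℝ[X]) (j : Fin M.N) : ℝ := (v j).eval (M.left j)

/-- The central flux `{v}` at the right end point of `I_j`. -/
def avgRight (v : Fin M.N → ℝ[X]) (j : Fin M.N) : ℝ :=
  (M.inRight v j + M.inLeft v (M.next j)) / 2

/-- The central flux `{v}` at the left end point of `I_j`. -/
def avgLeft (v : Fin M.N → ℝ[X]) (j : Fin M.N) : ℝ :=
  (M.inRight v (M.prev j) + M.inLeft v j) / 2

/-- The expression
`∫_{I_j} w_x φ_x dx - {w_x} φ |_{∂I_j} - (w - {w}) φ_x |_{∂I_j}`, where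
`v |_{∂I_j}` is the value of `v` at the right end minus its value at the left end of `I_j`,
both taken from inside `I_j`. -/
def cellForm (w φ : Fin M.N → ℝ[X]) (j : Fin M.N) : ℝ :=
  (∫ x in (M.left j)..(M.right j), (M.dx w j).eval x * (M.dx φ j).eval x)
    - (M.avgRight (M.dx w) j * M.inRight φ j - M.avgLeft (M.dx w) j * M.inLeft φ j)
    - ((M.inRight w j - M.avgRight w j) * M.inRight (M.dx φ) j
        - (M.inLeft w j - M.avgLeft w j) * M.inLeft (M.dx φ) j)

/-- The `L²(a, b)` distance of a piecewise polynomial `v` to a function `w`. -/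
def l2Dist (v : Fin M.N → ℝ[X]) (w : ℝ → ℝ) : ℝ :=
  Real.sqrt (∑ j, ∫ x in (M.left j)..(M.right j), ((v j).eval x - w x) ^ 2)

/-- `v` is the piecewise `L²` projection of `w` onto polynomials of degree at most `k`. -/
def IsL2Projection (k : ℕ) (w : ℝ → ℝ) (v : Fin M.N → ℝ[X]) : Prop :=
  v ∈ M.dgSpace k ∧
    ∀ φ ∈ degreeLE ℝ (k : WithBot ℕ), ∀ j,
      ∫ x in (M.left j)..(M.right j), (w x - (v j).eval x) * φ.eval x = 0

/-- `(uh, qh)` solves, for `0 ≤ t ≤ T`, the semi-discrete penalty-free mixed DG scheme with central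
fluxes, with initial data the piecewise `L²` projection of `u₀`. -/
structure IsSemiDiscreteSolution (k : ℕ) (T : ℝ) (u₀ : ℝ → ℝ)
    (uh qh : ℝ → Fin M.N → ℝ[X]) : Prop where
  uh_mem : ∀ t ∈ Set.Icc 0 T, uh t ∈ M.dgSpace k
  qh_mem : ∀ t ∈ Set.Icc 0 T, qh t ∈ M.dgSpace k
  differentiable : ∀ j x, DifferentiableOn ℝ (fun s => (uh s j).eval x) (Set.Icc 0 T)
  eq_u : ∀ t ∈ Set.Icc 0 T, ∀ φ ∈ M.dgSpace k, ∀ j,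
    ∫ x in (M.left j)..(M.right j),
      derivWithin (fun s => (uh s j).eval x) (Set.Icc 0 T) t * (φ j).eval x
        = - M.cellForm (qh t) φ j
  eq_q : ∀ t ∈ Set.Icc 0 T, ∀ ψ ∈ M.dgSpace k, ∀ j,
    ∫ x in (M.left j)..(M.right j), (qh t j).eval x * (ψ j).eval x = M.cellForm (uh t) ψ j
  initial : M.IsL2Projection k u₀ (uh 0)

end Mesh

/-- The Sobolev seminorm `|w|_m = ‖w^{(m)}‖_{L²(a, b)}` of a smooth function `w`. -/
def sobolevSeminorm (a b : ℝ) (m : ℕ) (w : ℝ → ℝ) : ℝ :=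
  Real.sqrt (∫ x in a..b, (iteratedDeriv m w x) ^ 2)

/-- The time derivative `u_t(·, t)` on `[0, T]` (one-sided at the end points). -/
def timeDeriv (T : ℝ) (u : ℝ → ℝ → ℝ) (t : ℝ) : ℝ → ℝ :=
  fun x => derivWithin (fun s => u x s) (Set.Icc 0 T) t

/-- `u = u(x, t)` is a smooth solution on `[0, T]` of `u_t = - u_xxxx` on `[a, b]` with periodic
boundary conditions and initial data `u₀`. As usual, a function with periodic boundary conditions
is regarded as a function on the real line with period `b - a`. -/
structure IsSmoothPeriodicSolution (a b T : ℝ) (u₀ : ℝ → ℝ) (u : ℝ → ℝ → ℝ) : Prop where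
  smooth : ContDiffOn ℝ (⊤ : ℕ∞) (fun p : ℝ × ℝ => u p.1 p.2) (Set.univ ×ˢ Set.Icc 0 T)
  periodic : ∀ t ∈ Set.Icc 0 T, Function.Periodic (fun x => u x t) (b - a)
  pde : ∀ t ∈ Set.Ioc 0 T, ∀ x, timeDeriv T u t x = - iteratedDeriv 4 (fun y => u y t) x
  initial : ∀ x, u x 0 = u₀ x

end MixedDG

end

namespace MixedDG

open Set intervalIntegral

/-! ### One-dimensional integral inequalities -/

/-! The estimate is an energy argument for the difference between the discrete solution and a
quasi-projection `P` of the exact one (`IsQuasiProjection`). Let q = -u_xx, so that q_xx = u_t, and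
put ξ = u_h - P u, ζ = q_h - P q. Summed over the cells, the form of the scheme is symmetric
(`Mesh.form_comm`). Testing the first equation with ξ and the second with ζ therefore cancels the
form terms in (ξ, ζ). What remains expresses ½ d/dt ‖ξ‖² + ‖ζ‖² through the approximation errors of
P u_t and P q and the defects of P u and P q in the form. If all of these are O(h^{k+1}), the terms
containing ζ are absorbed by ‖ζ‖² (`IsQuasiProjection.energy_le`), and `sqrt_le_of_deriv_le` gives a
bound on ‖ξ‖ growing only linearly in T.

Everything thus rests on an operator P with optimal L² error, with form (P w) φ = -∫ w'' φ up to
O(h^{k+1})‖φ‖, and compatible with ∂_t. By `Mesh.cellForm_add_integral` the defect of P w consists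
of moments of w - P w against φ_xx and of the mismatches of the central fluxes {P w}, {(P w)_x} at
the interfaces.

For k ≥ 2, P w is prescribed by exact fluxes and exact moments up to degree k - 2, so the defect
vanishes. Vanishing averages of e = w - P w and e_x make the boundary terms of ∫ e_x² cancel across
interfaces. Hence ‖e_x‖² ≤ ‖e‖ ‖w'' - p‖ for suitable piecewise polynomials p of degree at most k -
2, and a Poincaré inequality closes the estimate on any mesh (`Mesh.l2Dist_le_of_flux_eq`). The same
estimate with w = 0 gives unique solvability.

For k = 1 there are no moments left. On a uniform mesh the linear interpolant is corrected by -y at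
the left and +y at the right end of each cell, with y = `nodalCorrection`. The flux {P w} is then
exact, and the error of {(P w)_x} is a second difference of y divided by 2h, which is small enough.
-/

theorem sq_sum_integral_mul_le {ι : Type*} [Fintype ι] {l r : ι → ℝ} (hlr : ∀ j, l j ≤ r j)
    {f g : ι → ℝ → ℝ} (hf : ∀ j, Continuous (f j)) (hg : ∀ j, Continuous (g j)) :
    (∑ j, ∫ x in (l j)..(r j), f j x * g j x) ^ 2 ≤
      (∑ j, ∫ x in (l j)..(r j), f j x ^ 2) * ∑ j, ∫ x in (l j)..(r j), g j x ^ 2 := by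
  have key : ∀ s : ℝ, 0 ≤ (∑ j, ∫ x in (l j)..(r j), g j x ^ 2) * (s * s)
      + (2 * ∑ j, ∫ x in (l j)..(r j), f j x * g j x) * s
      + ∑ j, ∫ x in (l j)..(r j), f j x ^ 2 := by
    intro s
    have h0 : 0 ≤ ∑ j, ∫ x in (l j)..(r j), (s * g j x + f j x) ^ 2 :=
      Finset.sum_nonneg fun j _ => integral_nonneg (hlr j) fun x _ => sq_nonneg _
    have h1 : ∀ j, ∫ x in (l j)..(r j), (s * g j x + f j x) ^ 2
        = (s * s) * (∫ x in (l j)..(r j), g j x ^ 2)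
          + (2 * s) * (∫ x in (l j)..(r j), f j x * g j x) + ∫ x in (l j)..(r j), f j x ^ 2 := by
      intro j
      have := hf j
      have := hg j
      rw [← intervalIntegral.integral_const_mul, ← intervalIntegral.integral_const_mul,
        ← integral_add, ← integral_add]
      · congr 1
        ext x
        ring
      all_goals exact Continuous.intervalIntegrable (by fun_prop) _ _
    simp only [h1, Finset.sum_add_distrib, ← Finset.mul_sum] at h0
    linarith
  have := discrim_le_zero key
  rw [discrim] at this
  linarith

theorem abs_sum_integral_mul_le {ι : Type*} [Fintype ι] {l r : ι → ℝ} (hlr : ∀ j, l j ≤ r j)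
    {f g : ι → ℝ → ℝ} (hf : ∀ j, Continuous (f j)) (hg : ∀ j, Continuous (g j)) :
    |∑ j, ∫ x in (l j)..(r j), f j x * g j x| ≤
      √(∑ j, ∫ x in (l j)..(r j), f j x ^ 2) * √(∑ j, ∫ x in (l j)..(r j), g j x ^ 2) := by
  rw [← Real.sqrt_mul (Finset.sum_nonneg fun j _ => integral_nonneg (hlr j) fun x _ => sq_nonneg _)]
  exact Real.abs_le_sqrt (sq_sum_integral_mul_le hlr hf hg)

theorem sq_integral_mul_le {l r : ℝ} (hlr : l ≤ r) {f g : ℝ → ℝ} (hf : Continuous f)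
    (hg : Continuous g) :
    (∫ x in l..r, f x * g x) ^ 2 ≤ (∫ x in l..r, f x ^ 2) * ∫ x in l..r, g x ^ 2 := by
  simpa using sq_sum_integral_mul_le (ι := Unit) (fun _ => hlr) (fun _ => hf) (fun _ => hg)

theorem integral_sq_mono {l r c d : ℝ} (hcl : c ≤ l) (hlr : l ≤ r) (hrd : r ≤ d) {f : ℝ → ℝ}
    (hf : Continuous f) : ∫ x in l..r, f x ^ 2 ≤ ∫ x in c..d, f x ^ 2 :=
  integral_mono_interval hcl hlr hrd (Filter.Eventually.of_forall fun x => sq_nonneg (f x))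
    (Continuous.intervalIntegrable (by fun_prop) _ _)

theorem sq_sub_le {l r : ℝ} {f : ℝ → ℝ} (hf : ContDiff ℝ 1 f) {c x : ℝ}
    (hc : c ∈ Icc l r) (hx : x ∈ Icc l r) :
    (f x - f c) ^ 2 ≤ (r - l) * ∫ y in l..r, deriv f y ^ 2 := by
  wlog hcx : c ≤ x generalizing c x
  · rw [← neg_sub, neg_sq]
    exact this hx hc (le_of_not_ge hcx)
  have hd : Continuous (deriv f) := hf.continuous_deriv le_rfl
  have h1 : ∫ y in c..x, deriv f y = f x - f c :=
    integral_deriv_eq_sub (fun y _ => (hf.differentiable one_ne_zero) y)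
      (hd.intervalIntegrable _ _)
  have h2 := sq_integral_mul_le hcx (continuous_const (y := (1 : ℝ))) hd
  simp only [one_mul, one_pow, intervalIntegral.integral_const, smul_eq_mul, mul_one, h1] at h2
  refine h2.trans (mul_le_mul (by linarith [hc.1, hx.2])
    (integral_sq_mono hc.1 hcx hx.2 hd) (integral_nonneg hcx fun y _ => sq_nonneg _)
    (by linarith [hc.1, hc.2]))

theorem integral_sq_le_of_forall_le {l r K : ℝ} (hlr : l ≤ r) {f : ℝ → ℝ} (hf : Continuous f)
    (h : ∀ x ∈ Icc l r, f x ^ 2 ≤ K) : ∫ x in l..r, f x ^ 2 ≤ (r - l) * K := by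
  have := integral_mono_on hlr (Continuous.intervalIntegrable (hf.pow 2) l r)
    (intervalIntegrable_const (μ := MeasureTheory.volume) (c := K)) h
  simpa using this

theorem integral_sq_le_of_eq_zero {l r : ℝ} {f : ℝ → ℝ} (hf : ContDiff ℝ 1 f) {c : ℝ}
    (hc : c ∈ Icc l r) (hfc : f c = 0) :
    ∫ x in l..r, f x ^ 2 ≤ (r - l) ^ 2 * ∫ x in l..r, deriv f x ^ 2 := by
  have := integral_sq_le_of_forall_le (hc.1.trans hc.2) hf.continuous fun x hx => by
    simpa [hfc] using sq_sub_le hf hc hx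
  rwa [← mul_assoc, ← sq] at this

theorem exists_eq_zero_of_integral_eq_zero {l r : ℝ} (hlr : l < r) {f : ℝ → ℝ}
    (hf : Continuous f) (h : ∫ x in l..r, f x = 0) : ∃ c ∈ Icc l r, f c = 0 := by
  by_contra! hne
  have hpos : (∀ x ∈ Icc l r, 0 < f x) ∨ ∀ x ∈ Icc l r, 0 < - f x := by
    rcases lt_or_gt_of_ne (hne l (left_mem_Icc.2 hlr.le)) with h0 | h0
    · right
      intro x hx
      by_contra hx'
      obtain ⟨c, hc, hfc⟩ := intermediate_value_Icc hx.1 hf.continuousOn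
        (show (0 : ℝ) ∈ Icc (f l) (f x) from ⟨h0.le, by linarith⟩)
      exact hne c ⟨hc.1, hc.2.trans hx.2⟩ hfc
    · left
      intro x hx
      by_contra hx'
      obtain ⟨c, hc, hfc⟩ := intermediate_value_Icc' hx.1 hf.continuousOn
        (show (0 : ℝ) ∈ Icc (f x) (f l) from ⟨by linarith, h0.le⟩)
      exact hne c ⟨hc.1, hc.2.trans hx.2⟩ hfc
  rcases hpos with hp | hp
  · exact (intervalIntegral_pos_of_pos_on (hf.intervalIntegrable _ _)
      (fun x hx => hp x (Ioo_subset_Icc_self hx)) hlr).ne' h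
  · have := intervalIntegral_pos_of_pos_on (hf.neg.intervalIntegrable l r)
      (fun x hx => hp x (Ioo_subset_Icc_self hx)) hlr
    simp [h] at this

theorem integral_sq_le_of_integral_eq_zero {l r : ℝ} (hlr : l < r) {f : ℝ → ℝ}
    (hf : ContDiff ℝ 1 f) (h : ∫ x in l..r, f x = 0) :
    ∫ x in l..r, f x ^ 2 ≤ (r - l) ^ 2 * ∫ x in l..r, deriv f x ^ 2 := by
  obtain ⟨c, hc, hfc⟩ := exists_eq_zero_of_integral_eq_zero hlr hf.continuous h
  exact integral_sq_le_of_eq_zero hf hc hfc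

theorem exists_derivative_eq (p : ℝ[X]) (n : ℕ) (hp : p ∈ degreeLT ℝ n) :
    ∃ q ∈ degreeLT ℝ (n + 1), derivative q = p := by
  induction n generalizing p with
  | zero =>
    refine ⟨0, Submodule.zero_mem _, ?_⟩
    have : p = 0 := by simpa [mem_degreeLT] using hp
    simp [this]
  | succ n ih =>
    have hp' : p - C (p.coeff n) * X ^ n ∈ degreeLT ℝ n := by
      rw [mem_degreeLT, degree_lt_iff_coeff_zero]
      rw [mem_degreeLT, degree_lt_iff_coeff_zero] at hp
      intro m hm
      rcases hm.eq_or_lt with rfl | hm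
      · simp
      · simp [hp m hm, coeff_X_pow, hm.ne']
    obtain ⟨q, hq, hqd⟩ := ih _ hp'
    refine ⟨q + C (p.coeff n / (n + 1)) * X ^ (n + 1), Submodule.add_mem _
      (degreeLT_mono (Nat.le_succ _) hq) ?_, ?_⟩
    · rw [mem_degreeLT]
      exact (degree_C_mul_X_pow_le _ _).trans_lt (by exact_mod_cast Nat.lt_succ_self _)
    · have : (n : ℝ) + 1 ≠ 0 := by positivity
      simp only [derivative_add, hqd, derivative_C_mul_X_pow, Nat.cast_add, Nat.cast_one,
        div_mul_cancel₀ _ this, Nat.add_sub_cancel]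
      ring

theorem contDiff_eval (p : ℝ[X]) {n : WithTop ℕ∞} : ContDiff ℝ n fun x => p.eval x := by
  simpa using p.contDiff_aeval (𝕜 := ℝ) n

theorem deriv_eval (p : ℝ[X]) : deriv (fun x => p.eval x) = fun x => (derivative p).eval x := by
  ext x
  exact p.deriv

/-- By induction on the order: an approximant of g' is integrated, with the constant chosen so that
the error vanishes at l. Each integration then gains a factor (r - l)² by
`integral_sq_le_of_eq_zero`. -/
theorem exists_polynomial_integral_sq_sub_le {l r : ℝ} (hlr : l ≤ r) (n : ℕ) {g : ℝ → ℝ}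
    (hg : ContDiff ℝ (⊤ : ℕ∞) g) :
    ∃ p ∈ degreeLT ℝ n, ∫ x in l..r, (g x - p.eval x) ^ 2 ≤
      (r - l) ^ (2 * n) * ∫ x in l..r, iteratedDeriv n g x ^ 2 := by
  induction n generalizing g with
  | zero => exact ⟨0, Submodule.zero_mem _, by simp⟩
  | succ n ih =>
    have hg' : ContDiff ℝ (⊤ : ℕ∞) (deriv g) := (contDiff_infty_iff_deriv.1 hg).2
    obtain ⟨p, hp, hpl⟩ := ih hg'
    obtain ⟨q, hq, hqd⟩ := exists_derivative_eq p n hp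
    refine ⟨q + C (g l - q.eval l), Submodule.add_mem _ hq ?_, ?_⟩
    · rw [mem_degreeLT]
      exact degree_C_le.trans_lt (by exact_mod_cast Nat.succ_pos _)
    · have hf : ContDiff ℝ 1 fun x => g x - (q + C (g l - q.eval l)).eval x :=
        (hg.of_le (by exact_mod_cast le_top)).sub (contDiff_eval _)
      have hd : deriv (fun x => g x - (q + C (g l - q.eval l)).eval x)
          = fun x => deriv g x - p.eval x := by
        ext x
        rw [deriv_fun_sub (hg.differentiable (by simp) x) ((Polynomial.differentiable _) x),
          deriv_eval]
        simp [hqd]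
      have h := integral_sq_le_of_eq_zero hf (left_mem_Icc.2 hlr) (by simp)
      rw [hd] at h
      refine h.trans ?_
      rw [iteratedDeriv_succ', mul_add, pow_add, mul_comm ((r - l) ^ (2 * n)), mul_assoc]
      exact mul_le_mul_of_nonneg_left hpl (by positivity)

namespace Mesh

variable {a b : ℝ} (M : Mesh a b)

/-! ### Geometry of a mesh -/

theorem N_pos (hab : a < b) : 0 < M.N := by
  rcases Nat.eq_zero_or_pos M.N with h | h
  · have : (0 : Fin (M.N + 1)) = Fin.last M.N := by
      ext
      simp [h]
    have h2 := M.last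
    rw [← this, M.first] at h2
    exact absurd h2 hab.ne
  · exact h

theorem left_lt_right (j : Fin M.N) : M.left j < M.right j :=
  M.strictMono (Fin.castSucc_lt_succ)

theorem left_le_right (j : Fin M.N) : M.left j ≤ M.right j := (M.left_lt_right j).le

theorem cellSize_pos (j : Fin M.N) : 0 < M.cellSize j := sub_pos.2 (M.left_lt_right j)

theorem cellSize_le_meshSize (j : Fin M.N) : M.cellSize j ≤ M.meshSize :=
  le_ciSup (Set.finite_range _).bddAbove j

theorem meshSize_pos (hab : a < b) : 0 < M.meshSize :=
  (M.cellSize_pos ⟨0, M.N_pos hab⟩).trans_le (M.cellSize_le_meshSize _)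

theorem prev_next (j : Fin M.N) : M.prev (M.next j) = j := Equiv.symm_apply_apply _ _

theorem next_prev (j : Fin M.N) : M.next (M.prev j) = j := Equiv.apply_symm_apply _ _

theorem sum_next (f : Fin M.N → ℝ) : ∑ j, f (M.next j) = ∑ j, f j :=
  Equiv.sum_comp (finRotate M.N) f

/-- The second alternative is the periodic wrap-around; on a mesh with one cell it is the one that
occurs. -/
theorem left_next (j : Fin M.N) :
    M.left (M.next j) = M.right j ∨ (M.left (M.next j) = a ∧ M.right j = b) := by
  obtain ⟨N, x, hx, h0, h1⟩ := M
  cases N with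
  | zero => exact j.elim0
  | succ n =>
    by_cases h : j = Fin.last n
    · right
      subst h
      refine ⟨?_, h1⟩
      simp only [left, next, finRotate_last]
      exact h0
    · left
      have h2 : (j : ℕ) < n := lt_of_le_of_ne (Nat.lt_succ_iff.1 j.2) fun h' => h (Fin.ext h')
      simp only [left, right, next]
      congr 1
      ext
      simp [finRotate_of_lt h2]

theorem apply_left_next {w : ℝ → ℝ} (hw : Function.Periodic w (b - a)) (j : Fin M.N) :
    w (M.left (M.next j)) = w (M.right j) := by
  rcases M.left_next j with h | ⟨h, h'⟩
  · rw [h]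
  · rw [h, h', ← hw a]
    congr 1
    ring

theorem apply_right_prev {w : ℝ → ℝ} (hw : Function.Periodic w (b - a)) (j : Fin M.N) :
    w (M.right (M.prev j)) = w (M.left j) := by
  rw [← M.apply_left_next hw, M.next_prev]

theorem sum_integral {f : ℝ → ℝ} (hf : Continuous f) :
    ∑ j, ∫ x in (M.left j)..(M.right j), f x = ∫ x in a..b, f x := by
  -- The minimum only serves to index the nodes by all natural numbers; indices beyond N do not
  -- enter the sum.
  let y : ℕ → ℝ := fun i => M.x ⟨min i M.N, by omega⟩
  have h := sum_integral_adjacent_intervals (f := f) (μ := MeasureTheory.volume) (a := y)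
    (n := M.N) (fun i _ => hf.intervalIntegrable _ _)
  have h0 : y 0 = a := by
    rw [← M.first]
    simp [y]
  have h1 : y M.N = b := by
    refine Eq.trans ?_ M.last
    simp [y, Fin.last]
  rw [h0, h1, ← Fin.sum_univ_eq_sum_range (fun i => ∫ x in (y i)..(y (i + 1)), f x)] at h
  rw [← h]
  refine Finset.sum_congr rfl fun j _ => ?_
  have h2 : y j = M.left j := by
    simp only [y, left]
    congr 1
    ext
    simp
  have h3 : y (j + 1) = M.right j := by
    simp only [y, right]
    congr 1
    ext
    simp
  rw [h2, h3]

theorem avgLeft_next (v : Fin M.N → ℝ[X]) (j : Fin M.N) :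
    M.avgLeft v (M.next j) = M.avgRight v j := by
  simp [avgLeft, avgRight, prev_next]

theorem avgLeft_eq (v : Fin M.N → ℝ[X]) (j : Fin M.N) :
    M.avgLeft v j = M.avgRight v (M.prev j) := by
  rw [← M.avgLeft_next, M.next_prev]

/-! ### The space of piecewise polynomials -/

theorem mem_dgSpace {k : ℕ} {v : Fin M.N → ℝ[X]} :
    v ∈ M.dgSpace k ↔ ∀ j, v j ∈ degreeLE ℝ (k : WithBot ℕ) := by
  simp [dgSpace, Submodule.mem_pi]

/-- The bilinear form of the scheme. -/
noncomputable def form (w φ : Fin M.N → ℝ[X]) : ℝ := ∑ j, M.cellForm w φ j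

theorem cellForm_sub_left (v w φ : Fin M.N → ℝ[X]) (j : Fin M.N) :
    M.cellForm (v - w) φ j = M.cellForm v φ j - M.cellForm w φ j := by
  have : ∫ x in (M.left j)..(M.right j), (M.dx (v - w) j).eval x * (M.dx φ j).eval x
      = (∫ x in (M.left j)..(M.right j), (M.dx v j).eval x * (M.dx φ j).eval x)
        - ∫ x in (M.left j)..(M.right j), (M.dx w j).eval x * (M.dx φ j).eval x := by
    rw [← intervalIntegral.integral_sub]
    · simp [dx, sub_mul]
    all_goals exact Continuous.intervalIntegrable (by fun_prop) _ _
  simp only [cellForm, this]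
  simp only [avgLeft, avgRight, inLeft, inRight, dx, Pi.sub_apply, eval_sub, derivative_sub]
  ring

theorem form_sub_left (v w φ : Fin M.N → ℝ[X]) :
    M.form (v - w) φ = M.form v φ - M.form w φ := by
  simp [form, cellForm_sub_left]

/-- Shifting the left-end terms to the neighbouring cell collects, at each interface, {v_x}[w] +
[v]{w_x}, where [·] is the jump. This is symmetric, and so is the volume term. -/
theorem form_comm (v w : Fin M.N → ℝ[X]) : M.form v w = M.form w v := by
  have key : ∀ v w : Fin M.N → ℝ[X], M.form v w
      = (∑ j, ∫ x in (M.left j)..(M.right j), (M.dx v j).eval x * (M.dx w j).eval x)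
        - ∑ j, (M.avgRight (M.dx v) j * (M.inRight w j - M.inLeft w (M.next j))
          + (M.inRight v j - M.inLeft v (M.next j)) * M.avgRight (M.dx w) j) := by
    intro v w
    have h1 := M.sum_next fun j => M.avgLeft (M.dx v) j * M.inLeft w j
    have h2 := M.sum_next fun j => (M.inLeft v j - M.avgLeft v j) * M.inLeft (M.dx w) j
    simp only [form, cellForm, Finset.sum_sub_distrib, ← h1, ← h2, avgLeft_next]
    rw [sub_sub, ← Finset.sum_sub_distrib, ← Finset.sum_sub_distrib, ← Finset.sum_add_distrib]
    congr 1
    refine Finset.sum_congr rfl fun j _ => ?_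
    simp only [avgRight]
    ring
  rw [key, key]
  congr 1
  · simp only [mul_comm]
  · exact Finset.sum_congr rfl fun j _ => by ring

/-- Consistency identity: integrating by parts twice for w and once for v leaves only the moment of
w - v against φ_xx and the flux mismatches at the two ends. -/
theorem cellForm_add_integral {w : ℝ → ℝ} (hw : ContDiff ℝ (⊤ : ℕ∞) w)
    (v φ : Fin M.N → ℝ[X]) (j : Fin M.N) :
    M.cellForm v φ j + ∫ x in (M.left j)..(M.right j), iteratedDeriv 2 w x * (φ j).eval x
      = (∫ x in (M.left j)..(M.right j),
          (w x - (v j).eval x) * (derivative (derivative (φ j))).eval x)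
        + (deriv w (M.right j) - M.avgRight (M.dx v) j) * M.inRight φ j
        - (deriv w (M.left j) - M.avgLeft (M.dx v) j) * M.inLeft φ j
        - (w (M.right j) - M.avgRight v j) * M.inRight (M.dx φ) j
        + (w (M.left j) - M.avgLeft v j) * M.inLeft (M.dx φ) j := by
  have hw' : ContDiff ℝ (⊤ : ℕ∞) (deriv w) := (contDiff_infty_iff_deriv.1 hw).2
  have hw'' : ContDiff ℝ (⊤ : ℕ∞) (deriv (deriv w)) := (contDiff_infty_iff_deriv.1 hw').2
  have c0 := hw.continuous
  have c1 := hw'.continuous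
  have c2 := hw''.continuous
  have d0 : ∀ x, HasDerivAt w (deriv w x) x := fun x => (hw.differentiable (by simp) x).hasDerivAt
  have d1 : ∀ x, HasDerivAt (deriv w) (deriv (deriv w) x) x :=
    fun x => (hw'.differentiable (by simp) x).hasDerivAt
  have e2 : iteratedDeriv 2 w = deriv (deriv w) := by
    rw [iteratedDeriv_succ, iteratedDeriv_one]
  have ii : ∀ {f : ℝ → ℝ}, Continuous f →
      IntervalIntegrable f MeasureTheory.volume (M.left j) (M.right j) :=
    fun h => h.intervalIntegrable _ _
  have i1 := integral_mul_deriv_eq_deriv_mul (a := M.left j) (b := M.right j)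
    (fun x _ => (φ j).hasDerivAt x) (fun x _ => d1 x) (ii (by fun_prop)) (ii c2)
  have i2 := integral_mul_deriv_eq_deriv_mul (a := M.left j) (b := M.right j)
    (fun x _ => (derivative (φ j)).hasDerivAt x) (fun x _ => d0 x) (ii (by fun_prop)) (ii c1)
  have i3 := integral_mul_deriv_eq_deriv_mul (a := M.left j) (b := M.right j)
    (fun x _ => (derivative (φ j)).hasDerivAt x) (fun x _ => (v j).hasDerivAt x)
    (ii (by fun_prop)) (ii (by fun_prop))
  have i4 : (∫ x in (M.left j)..(M.right j),
          (w x - (v j).eval x) * (derivative (derivative (φ j))).eval x)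
      = (∫ x in (M.left j)..(M.right j), (derivative (derivative (φ j))).eval x * w x)
        - ∫ x in (M.left j)..(M.right j),
          (derivative (derivative (φ j))).eval x * (v j).eval x := by
    rw [← intervalIntegral.integral_sub (ii (by fun_prop)) (ii (by fun_prop))]
    congr 1
    ext x
    ring
  have i5 : (∫ x in (M.left j)..(M.right j), (M.dx v j).eval x * (M.dx φ j).eval x)
      = ∫ x in (M.left j)..(M.right j),
        (derivative (φ j)).eval x * (derivative (v j)).eval x := by
    simp only [dx, mul_comm]
  have i6 : (∫ x in (M.left j)..(M.right j), iteratedDeriv 2 w x * (φ j).eval x)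
      = ∫ x in (M.left j)..(M.right j), (φ j).eval x * deriv (deriv w) x := by
    simp only [e2, mul_comm]
  rw [cellForm, i4, i5, i6, i1, i2, i3]
  simp only [inLeft, inRight, dx]
  ring

/-- The broken `L²` norm of a piecewise polynomial. -/
noncomputable def norm (v : Fin M.N → ℝ[X]) : ℝ :=
  √(∑ j, ∫ x in (M.left j)..(M.right j), (v j).eval x ^ 2)

theorem norm_nonneg (v : Fin M.N → ℝ[X]) : 0 ≤ M.norm v := Real.sqrt_nonneg _

theorem sum_integral_sq_nonneg (f : Fin M.N → ℝ → ℝ) :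
    0 ≤ ∑ j, ∫ x in (M.left j)..(M.right j), f j x ^ 2 :=
  Finset.sum_nonneg fun j _ => integral_nonneg (M.left_le_right j) fun _ _ => sq_nonneg _

theorem norm_sq (v : Fin M.N → ℝ[X]) :
    M.norm v ^ 2 = ∑ j, ∫ x in (M.left j)..(M.right j), (v j).eval x ^ 2 :=
  Real.sq_sqrt (M.sum_integral_sq_nonneg _)

theorem l2Dist_nonneg (v : Fin M.N → ℝ[X]) (w : ℝ → ℝ) : 0 ≤ M.l2Dist v w := Real.sqrt_nonneg _

theorem abs_sum_integral_sub_mul_le (v φ : Fin M.N → ℝ[X]) {w : ℝ → ℝ} (hw : Continuous w) :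
    |∑ j, ∫ x in (M.left j)..(M.right j), ((v j).eval x - w x) * (φ j).eval x|
      ≤ M.l2Dist v w * M.norm φ :=
  abs_sum_integral_mul_le M.left_le_right (fun j => by fun_prop) fun j => by fun_prop

theorem l2Dist_le_add (u v : Fin M.N → ℝ[X]) {w : ℝ → ℝ} (hw : Continuous w) :
    M.l2Dist u w ≤ M.norm (u - v) + M.l2Dist v w := by
  have h := (abs_le.1 (M.abs_sum_integral_sub_mul_le v (u - v) hw)).2
  have h1 : M.l2Dist u w ^ 2 = M.norm (u - v) ^ 2 + M.l2Dist v w ^ 2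
      + 2 * ∑ j, ∫ x in (M.left j)..(M.right j), ((v j).eval x - w x) * ((u - v) j).eval x := by
    rw [norm_sq, l2Dist, l2Dist, Real.sq_sqrt (M.sum_integral_sq_nonneg _),
      Real.sq_sqrt (M.sum_integral_sq_nonneg _), Finset.mul_sum, ← Finset.sum_add_distrib,
      ← Finset.sum_add_distrib]
    refine Finset.sum_congr rfl fun j _ => ?_
    rw [← intervalIntegral.integral_const_mul, ← intervalIntegral.integral_add,
      ← intervalIntegral.integral_add]
    · congr 1
      ext x
      simp only [Pi.sub_apply, eval_sub]
      ring
    all_goals exact Continuous.intervalIntegrable (by fun_prop) _ _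
  refine abs_le_of_sq_le_sq' ?_ (add_nonneg (M.norm_nonneg _) (M.l2Dist_nonneg _ _)) |>.2
  nlinarith

end Mesh

/-! ### Smooth functions of x and t, and functionals commuting with the time derivative -/

theorem continuous_iteratedDeriv {w : ℝ → ℝ} (hw : ContDiff ℝ (⊤ : ℕ∞) w) (n : ℕ) :
    Continuous (iteratedDeriv n w) :=
  (contDiff_infty.1 hw n).continuous_iteratedDeriv n le_rfl

theorem periodic_deriv {w : ℝ → ℝ} {c : ℝ} (hw : Function.Periodic w c) :
    Function.Periodic (deriv w) c := fun x => by
  rw [← deriv_comp_add_const]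
  exact congrArg (fun f => deriv f x) (funext hw)

/-- A functional commutes with the time derivative of smooth functions on `ℝ × [0, T]`. -/
def CommutesWithTimeDeriv (ℓ : (ℝ → ℝ) → ℝ) : Prop :=
  ∀ (T : ℝ) (u : ℝ → ℝ → ℝ), 0 < T →
    ContDiffOn ℝ (⊤ : ℕ∞) (fun p : ℝ × ℝ => u p.1 p.2) (univ ×ˢ Icc 0 T) →
      ContinuousOn (fun s => ℓ fun x => u x s) (Icc 0 T) ∧
        ∀ t ∈ Ioo 0 T, HasDerivAt (fun s => ℓ fun x => u x s) (ℓ (timeDeriv T u t)) t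

theorem CommutesWithTimeDeriv.mul_const {ℓ : (ℝ → ℝ) → ℝ} (h : CommutesWithTimeDeriv ℓ) (c : ℝ) :
    CommutesWithTimeDeriv fun w => ℓ w * c := fun T u hT hu =>
  ⟨(h T u hT hu).1.mul continuousOn_const, fun t ht => ((h T u hT hu).2 t ht).mul_const c⟩

theorem CommutesWithTimeDeriv.add {ℓ ℓ' : (ℝ → ℝ) → ℝ} (h : CommutesWithTimeDeriv ℓ)
    (h' : CommutesWithTimeDeriv ℓ') : CommutesWithTimeDeriv fun w => ℓ w + ℓ' w :=
  fun T u hT hu => ⟨(h T u hT hu).1.add (h' T u hT hu).1,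
    fun t ht => ((h T u hT hu).2 t ht).add ((h' T u hT hu).2 t ht)⟩

theorem CommutesWithTimeDeriv.sum {ι : Type*} [Fintype ι] {ℓ : ι → (ℝ → ℝ) → ℝ}
    (h : ∀ i, CommutesWithTimeDeriv (ℓ i)) : CommutesWithTimeDeriv fun w => ∑ i, ℓ i w :=
  fun T u hT hu => ⟨continuousOn_finsetSum _ fun i _ => (h i T u hT hu).1,
    fun t ht => HasDerivAt.fun_sum fun i _ => (h i T u hT hu).2 t ht⟩

theorem contDiff_slice {T : ℝ} {u : ℝ → ℝ → ℝ}
    (hu : ContDiffOn ℝ (⊤ : ℕ∞) (fun p : ℝ × ℝ => u p.1 p.2) (univ ×ˢ Icc 0 T)) {t : ℝ}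
    (ht : t ∈ Icc 0 T) : ContDiff ℝ (⊤ : ℕ∞) fun x => u x t := by
  rw [← contDiffOn_univ]
  exact hu.comp (f := fun x : ℝ => (x, t)) (by fun_prop) fun x _ => ⟨mem_univ _, ht⟩

theorem contDiffAt_of_mem_Ioo {T : ℝ} {u : ℝ → ℝ → ℝ}
    (hu : ContDiffOn ℝ (⊤ : ℕ∞) (fun p : ℝ × ℝ => u p.1 p.2) (univ ×ˢ Icc 0 T)) (x : ℝ) {t : ℝ}
    (ht : t ∈ Ioo 0 T) : ContDiffAt ℝ (⊤ : ℕ∞) (fun p : ℝ × ℝ => u p.1 p.2) (x, t) :=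
  hu.contDiffAt (prod_mem_nhds Filter.univ_mem (Icc_mem_nhds ht.1 ht.2))

theorem timeDeriv_eq_fderiv {T : ℝ} {u : ℝ → ℝ → ℝ}
    (hu : ContDiffOn ℝ (⊤ : ℕ∞) (fun p : ℝ × ℝ => u p.1 p.2) (univ ×ˢ Icc 0 T)) (x : ℝ) {t : ℝ}
    (ht : t ∈ Ioo 0 T) :
    HasDerivAt (fun s => u x s) (timeDeriv T u t x) t ∧
      timeDeriv T u t x = fderiv ℝ (fun p : ℝ × ℝ => u p.1 p.2) (x, t) (0, 1) := by
  have h1 : HasDerivAt (fun s => u x s)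
      (fderiv ℝ (fun p : ℝ × ℝ => u p.1 p.2) (x, t) (0, 1)) t :=
    ((contDiffAt_of_mem_Ioo hu x ht).differentiableAt (by simp)).hasFDerivAt.comp_hasDerivAt
      (f := fun s : ℝ => (x, s)) t ((hasDerivAt_const t x).prodMk (hasDerivAt_id t))
  have h2 : timeDeriv T u t x = fderiv ℝ (fun p : ℝ × ℝ => u p.1 p.2) (x, t) (0, 1) := by
    rw [timeDeriv, derivWithin_of_mem_nhds (Icc_mem_nhds ht.1 ht.2), h1.deriv]
  exact ⟨h2 ▸ h1, h2⟩

theorem commutesWithTimeDeriv_eval (x : ℝ) : CommutesWithTimeDeriv fun w => w x :=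
  fun T u _ hu => ⟨hu.continuousOn.comp (f := fun s : ℝ => (x, s)) (by fun_prop)
    fun s hs => ⟨mem_univ _, hs⟩, fun t ht => (timeDeriv_eq_fderiv hu x ht).1⟩

theorem deriv_slice {T : ℝ} {u : ℝ → ℝ → ℝ}
    (hu : ContDiffOn ℝ (⊤ : ℕ∞) (fun p : ℝ × ℝ => u p.1 p.2) (univ ×ˢ Icc 0 T)) (x : ℝ) {t : ℝ}
    (ht : t ∈ Icc 0 T) : deriv (fun x => u x t) x
      = fderivWithin ℝ (fun p : ℝ × ℝ => u p.1 p.2) (univ ×ˢ Icc 0 T) (x, t) (1, 0) := by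
  have h := ((hu.differentiableOn (by simp)) (x, t) ⟨mem_univ _, ht⟩).hasFDerivWithinAt
  have h2 := h.comp_hasDerivWithinAt (f := fun y : ℝ => (y, t)) (s := univ) x
    ((hasDerivAt_id x).prodMk (hasDerivAt_const x t)).hasDerivWithinAt
    (fun y _ => ⟨mem_univ _, ht⟩)
  exact (hasDerivWithinAt_univ.1 h2).deriv

/-- Inside the time interval this is the equality of mixed partial derivatives. Continuity up to t =
0 and t = T comes from the derivative within the closed strip. -/
theorem commutesWithTimeDeriv_deriv (x : ℝ) : CommutesWithTimeDeriv fun w => deriv w x := by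
  intro T u hT hu
  refine ⟨?_, fun t ht => ?_⟩
  · have h1 := hu.continuousOn_fderivWithin
      (uniqueDiffOn_univ.prod (uniqueDiffOn_Icc hT)) (by simp)
    have h2 : ContinuousOn (fun s => fderivWithin ℝ (fun p : ℝ × ℝ => u p.1 p.2)
        (univ ×ˢ Icc 0 T) (x, s) (1, 0)) (Icc 0 T) :=
      (h1.comp (f := fun s : ℝ => (x, s)) (by fun_prop) fun s hs => ⟨mem_univ _, hs⟩).clm_apply
        continuousOn_const
    exact h2.congr fun s hs => deriv_slice hu x hs
  · set f : ℝ × ℝ → ℝ := fun p => u p.1 p.2 with hf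
    have hfx := contDiffAt_of_mem_Ioo hu x ht
    have hD : DifferentiableAt ℝ (fderiv ℝ f) (x, t) :=
      (hfx.fderiv_right (m := (⊤ : ℕ∞)) (by simp)).differentiableAt (by simp)
    have h1 : HasDerivAt (fun s => fderiv ℝ f (x, s) (1, 0))
        (fderiv ℝ (fderiv ℝ f) (x, t) (0, 1) (1, 0)) t :=
      (hD.hasFDerivAt.comp_hasDerivAt (f := fun s : ℝ => (x, s)) t
        ((hasDerivAt_const t x).prodMk (hasDerivAt_id t))).clm_apply (hasDerivAt_const t _)
        |>.congr_deriv (by simp)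
    have h2 : HasDerivAt (fun y => fderiv ℝ f (y, t) (0, 1))
        (fderiv ℝ (fderiv ℝ f) (x, t) (1, 0) (0, 1)) x :=
      (hD.hasFDerivAt.comp_hasDerivAt (f := fun y : ℝ => (y, t)) x
        ((hasDerivAt_id x).prodMk (hasDerivAt_const x t))).clm_apply (hasDerivAt_const x _)
        |>.congr_deriv (by simp)
    have h3 : timeDeriv T u t = fun y => fderiv ℝ f (y, t) (0, 1) := by
      ext y
      exact (timeDeriv_eq_fderiv hu y ht).2
    have hsymm : fderiv ℝ (fderiv ℝ f) (x, t) (0, 1) (1, 0)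
        = fderiv ℝ (fderiv ℝ f) (x, t) (1, 0) (0, 1) :=
      (hfx.of_le (m := (2 : ℕ∞)) (by exact_mod_cast le_top)).isSymmSndFDerivAt (by simp) _ _
    beta_reduce
    rw [h3, h2.deriv, ← hsymm]
    refine h1.congr_of_eventuallyEq ?_
    filter_upwards [isOpen_Ioo.mem_nhds ht] with s hs
    have := ((contDiffAt_of_mem_Ioo hu x hs).differentiableAt (by simp)).hasFDerivAt.comp_hasDerivAt
      (f := fun y : ℝ => (y, s)) x ((hasDerivAt_id x).prodMk (hasDerivAt_const x s))
    exact this.deriv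

theorem commutesWithTimeDeriv_integral (l r : ℝ) {g : ℝ → ℝ} (hg : Continuous g) :
    CommutesWithTimeDeriv fun w => ∫ x in l..r, w x * g x := by
  intro T u hT hu
  have hslice : ∀ s ∈ Icc 0 T, Continuous fun x => u x s := fun s hs =>
    (contDiff_slice hu hs).continuous
  refine ⟨?_, fun t ht => ?_⟩
  -- Clamping the time to [0, T] turns the integrand into a jointly continuous function on the whole
  -- plane.
  · have h1 : Continuous fun p : ℝ × ℝ => u p.2 (projIcc 0 T hT.le p.1) * g p.2 := by
      refine Continuous.mul ?_ (hg.comp continuous_snd)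
      exact hu.continuousOn.comp_continuous
        (f := fun p : ℝ × ℝ => (p.2, (projIcc 0 T hT.le p.1 : ℝ)))
        (continuous_snd.prodMk (continuous_subtype_val.comp
          (continuous_projIcc.comp continuous_fst))) fun p => ⟨mem_univ _, Subtype.coe_prop _⟩
    have h2 : Continuous fun s => ∫ x in l..r, u x (projIcc 0 T hT.le s) * g x :=
      continuous_parametric_intervalIntegral_of_continuous' h1 l r
    refine h2.continuousOn.congr fun s hs => ?_
    simp only [projIcc_of_mem hT.le hs]
  · set f : ℝ × ℝ → ℝ := fun p => u p.1 p.2 with hf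
    have hc : ContinuousOn (fun p : ℝ × ℝ => fderiv ℝ f p (0, 1) * g p.1) (univ ×ˢ Ioo 0 T) := by
      refine ContinuousOn.mul ?_ (hg.comp continuous_fst).continuousOn
      refine ContinuousOn.clm_apply ?_ continuousOn_const
      exact (hu.mono (prod_mono le_rfl Ioo_subset_Icc_self)).continuousOn_fderiv_of_isOpen
        (isOpen_univ.prod isOpen_Ioo) (by simp)
    obtain ⟨ε, hε, hball⟩ := Metric.nhds_basis_closedBall.mem_iff.1 (isOpen_Ioo.mem_nhds ht)
    have hsub : uIcc l r ×ˢ Metric.closedBall t ε ⊆ univ ×ˢ Ioo 0 T := prod_mono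
      (subset_univ _) hball
    obtain ⟨K, hK⟩ := (isCompact_uIcc.prod (isCompact_closedBall t ε)).exists_bound_of_continuousOn
      (hc.mono hsub)
    have hcs : ∀ s ∈ Ioo 0 T, Continuous fun x => fderiv ℝ f (x, s) (0, 1) * g x := fun s hs =>
      hc.comp_continuous (f := fun x : ℝ => (x, s)) (by fun_prop) fun x => ⟨mem_univ _, hs⟩
    have := (hasDerivAt_integral_of_dominated_loc_of_deriv_le (μ := MeasureTheory.volume)
      (F := fun s x => u x s * g x) (F' := fun s x => fderiv ℝ f (x, s) (0, 1) * g x)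
      (a := l) (b := r) (x₀ := t) (s := Metric.closedBall t ε) (bound := fun _ => K)
      (Metric.closedBall_mem_nhds t hε) ?_ ?_ ?_ ?_ ?_ ?_).2
    · exact this.congr_deriv (integral_congr fun x _ => by
        simp only [(timeDeriv_eq_fderiv hu x ht).2, hf])
    · filter_upwards [Icc_mem_nhds ht.1 ht.2] with s hs
      exact ((hslice s hs).mul hg).aestronglyMeasurable
    · exact ((hslice t (Ioo_subset_Icc_self ht)).mul hg).intervalIntegrable _ _
    · exact (hcs t ht).aestronglyMeasurable
    · exact Filter.Eventually.of_forall fun x hx s hs => hK (x, s) ⟨uIoc_subset_uIcc hx, hs⟩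
    · exact intervalIntegrable_const
    · refine Filter.Eventually.of_forall fun x _ s hs => ?_
      have h := timeDeriv_eq_fderiv hu x (hball hs)
      exact (h.2 ▸ h.1).mul_const _

/-- A linear projection-like operator onto `V_h^k` that has the optimal approximation order and
almost commutes with the fourth order form. -/
structure IsQuasiProjection {a b : ℝ} (M : Mesh a b) (k : ℕ) (K : ℝ)
    (P : (ℝ → ℝ) → Fin M.N → ℝ[X]) : Prop where
  mem : ∀ w, P w ∈ M.dgSpace k
  l2Dist_le : ∀ w, ContDiff ℝ (⊤ : ℕ∞) w → Function.Periodic w (b - a) →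
    M.l2Dist (P w) w ≤ K * M.meshSize ^ (k + 1) * sobolevSeminorm a b (k + 1) w
  abs_form_add_le : ∀ w, ContDiff ℝ (⊤ : ℕ∞) w → Function.Periodic w (b - a) →
    ∀ φ ∈ M.dgSpace k,
      |M.form (P w) φ + ∑ j, ∫ x in (M.left j)..(M.right j), iteratedDeriv 2 w x * (φ j).eval x|
        ≤ K * M.meshSize ^ (k + 1) * sobolevSeminorm a b (k + 3) w * M.norm φ
  commutes : ∀ j x, CommutesWithTimeDeriv fun w => (P w j).eval x

/-! ### The flux projection for degree at least two -/

namespace Mesh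

variable {a b : ℝ} (M : Mesh a b)

/-- With e = w - v: {e} = {e_x} = 0 removes the boundary terms, so ∫ e_x² = -∫ e e_xx after
summation. Orthogonality replaces v_xx by a local approximant p of w''. Since e has mean zero on
each cell, ‖e‖² ≤ h²‖e_x‖² ≤ h²‖e‖‖w'' - p‖, and one factor ‖e‖ is divided out. No comparison
between neighbouring cell sizes is needed. -/
theorem l2Dist_le_of_flux_eq (hab : a < b) {m : ℕ} {v : Fin M.N → ℝ[X]} {w : ℝ → ℝ}
    (hv : v ∈ M.dgSpace (m + 2)) (hw : ContDiff ℝ (⊤ : ℕ∞) w)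
    (hper : Function.Periodic w (b - a))
    (hmom : ∀ j, ∀ p ∈ degreeLE ℝ (m : WithBot ℕ),
      ∫ x in (M.left j)..(M.right j), (w x - (v j).eval x) * p.eval x = 0)
    (hval : ∀ j, M.avgRight v j = w (M.right j))
    (hder : ∀ j, M.avgRight (M.dx v) j = deriv w (M.right j)) :
    M.l2Dist v w ≤ M.meshSize ^ (m + 3) * sobolevSeminorm a b (m + 3) w := by
  have hh := M.meshSize_pos hab
  have hw' : ContDiff ℝ (⊤ : ℕ∞) (deriv w) := (contDiff_infty_iff_deriv.1 hw).2
  have hw'' : ContDiff ℝ (⊤ : ℕ∞) (deriv (deriv w)) := (contDiff_infty_iff_deriv.1 hw').2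
  have hper' := periodic_deriv hper
  have c0 := hw.continuous
  have c1 := hw'.continuous
  have c2 := hw''.continuous
  set e : Fin M.N → ℝ → ℝ := fun j x => w x - (v j).eval x with he
  set e' : Fin M.N → ℝ → ℝ := fun j x => deriv w x - (derivative (v j)).eval x with he'
  set e'' : Fin M.N → ℝ → ℝ := fun j x =>
    deriv (deriv w) x - (derivative (derivative (v j))).eval x with he''
  have d0 : ∀ j x, HasDerivAt (e j) (e' j x) x := fun j x =>
    (hw.differentiable (by simp) x).hasDerivAt.sub ((v j).hasDerivAt x)
  have d1 : ∀ j x, HasDerivAt (e' j) (e'' j x) x := fun j x =>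
    (hw'.differentiable (by simp) x).hasDerivAt.sub ((derivative (v j)).hasDerivAt x)
  have ce : ∀ j, Continuous (e j) := fun j => by fun_prop
  have ce' : ∀ j, Continuous (e' j) := fun j => by fun_prop
  have ce'' : ∀ j, Continuous (e'' j) := fun j => by fun_prop
  -- Zero averages mean that e and e_x both change sign across an interface, so the product e e_x is
  -- continuous there and the sum telescopes cyclically.
  have hflux : ∑ j, (e j (M.right j) * e' j (M.right j) - e j (M.left j) * e' j (M.left j)) = 0 := by
    rw [Finset.sum_sub_distrib, ← M.sum_next fun j => e j (M.left j) * e' j (M.left j),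
      ← Finset.sum_sub_distrib]
    refine Finset.sum_eq_zero fun j _ => ?_
    have h1 := hval j
    have h2 := hder j
    simp only [avgRight, inRight, inLeft, dx] at h1 h2
    simp only [he, he', M.apply_left_next hper, M.apply_left_next hper']
    have h3 : (v (M.next j)).eval (M.left (M.next j))
        = 2 * w (M.right j) - (v j).eval (M.right j) := by linarith
    have h4 : (derivative (v (M.next j))).eval (M.left (M.next j))
        = 2 * deriv w (M.right j) - (derivative (v j)).eval (M.right j) := by linarith
    rw [h3, h4]
    ring
  have happrox : ∀ j, ∃ p ∈ degreeLT ℝ (m + 1),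
      ∫ x in (M.left j)..(M.right j), (deriv (deriv w) x - p.eval x) ^ 2 ≤
      (M.right j - M.left j) ^ (2 * (m + 1)) *
        ∫ x in (M.left j)..(M.right j), iteratedDeriv (m + 1) (deriv (deriv w)) x ^ 2 :=
    fun j => exists_polynomial_integral_sq_sub_le (M.left_le_right j) (m + 1) hw''
  choose p hp hpl using happrox
  -- Both p and v_xx have degree at most m, so their difference is a test function for the moment
  -- condition.
  have hdeg : ∀ j, p j - derivative (derivative (v j)) ∈ degreeLE ℝ (m : WithBot ℕ) := by
    intro j
    refine Submodule.sub_mem _ ?_ ?_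
    · rw [mem_degreeLE]
      have := hp j
      rw [mem_degreeLT, degree_lt_iff_coeff_zero] at this
      rw [degree_le_iff_coeff_zero]
      exact fun n hn => this n (by exact_mod_cast hn)
    · have hvj := M.mem_dgSpace.1 hv j
      rw [mem_degreeLE, degree_le_iff_coeff_zero] at hvj ⊢
      intro n hn
      have hn' : m < n := by exact_mod_cast hn
      simp only [coeff_derivative]
      rw [hvj (n + 1 + 1) (by exact_mod_cast (by omega : m + 2 < n + 1 + 1))]
      simp
  have hcell : ∀ j, ∫ x in (M.left j)..(M.right j), e' j x ^ 2
      = (e j (M.right j) * e' j (M.right j) - e j (M.left j) * e' j (M.left j))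
        - ∫ x in (M.left j)..(M.right j), e j x * (deriv (deriv w) x - (p j).eval x) := by
    intro j
    have h1 := integral_mul_deriv_eq_deriv_mul (a := M.left j) (b := M.right j)
      (fun x _ => d0 j x) (fun x _ => d1 j x) ((ce' j).intervalIntegrable _ _)
      ((ce'' j).intervalIntegrable _ _)
    have h2 : ∫ x in (M.left j)..(M.right j), e j x * e'' j x
        = (∫ x in (M.left j)..(M.right j), e j x * (deriv (deriv w) x - (p j).eval x))
          + ∫ x in (M.left j)..(M.right j),
            e j x * (p j - derivative (derivative (v j))).eval x := by
      rw [← intervalIntegral.integral_add]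
      · congr 1
        ext x
        simp only [he'', eval_sub]
        ring
      all_goals exact Continuous.intervalIntegrable (by fun_prop) _ _
    rw [hmom j _ (hdeg j), add_zero] at h2
    simp only [sq]
    linarith
  have hY := M.sum_integral_sq_nonneg e
  have hXYZ : ∑ j, ∫ x in (M.left j)..(M.right j), e' j x ^ 2
      ≤ √(∑ j, ∫ x in (M.left j)..(M.right j), e j x ^ 2) *
        √(∑ j, ∫ x in (M.left j)..(M.right j), (deriv (deriv w) x - (p j).eval x) ^ 2) := by
    have h1 := abs_sum_integral_mul_le M.left_le_right ce
      (g := fun j x => deriv (deriv w) x - (p j).eval x) fun j => by fun_prop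
    rw [Finset.sum_congr rfl fun j _ => hcell j, Finset.sum_sub_distrib, hflux, zero_sub]
    exact (neg_le_abs _).trans h1
  have hYX : ∑ j, ∫ x in (M.left j)..(M.right j), e j x ^ 2
      ≤ M.meshSize ^ 2 * ∑ j, ∫ x in (M.left j)..(M.right j), e' j x ^ 2 := by
    rw [Finset.mul_sum]
    refine Finset.sum_le_sum fun j _ => ?_
    have h1 : ∫ x in (M.left j)..(M.right j), e j x = 0 := by
      simpa using hmom j 1 (by
        rw [mem_degreeLE]
        exact degree_one_le.trans (by exact_mod_cast Nat.zero_le m))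
    have h2 := integral_sq_le_of_integral_eq_zero (M.left_lt_right j)
      ((hw.of_le (by exact_mod_cast le_top)).sub (contDiff_eval (v j))) h1
    rw [funext fun x => (d0 j x).deriv] at h2
    refine h2.trans (mul_le_mul_of_nonneg_right ?_ (integral_nonneg (M.left_le_right j)
      fun _ _ => sq_nonneg _))
    exact pow_le_pow_left₀ (M.cellSize_pos j).le (M.cellSize_le_meshSize j) 2
  have hZw : √(∑ j, ∫ x in (M.left j)..(M.right j), (deriv (deriv w) x - (p j).eval x) ^ 2)
      ≤ M.meshSize ^ (m + 1) * sobolevSeminorm a b (m + 3) w := by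
    have hit : iteratedDeriv (m + 1) (deriv (deriv w)) = iteratedDeriv (m + 3) w := by
      rw [← iteratedDeriv_succ', ← iteratedDeriv_succ']
    have hci : Continuous (iteratedDeriv (m + 3) w) :=
      continuous_iteratedDeriv hw _
    refine Real.sqrt_le_iff.2 ⟨mul_nonneg (by positivity) (Real.sqrt_nonneg _), ?_⟩
    rw [mul_pow, sobolevSeminorm, Real.sq_sqrt (integral_nonneg hab.le fun _ _ => sq_nonneg _),
      ← M.sum_integral (by fun_prop : Continuous fun x => iteratedDeriv (m + 3) w x ^ 2),
      Finset.mul_sum]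
    refine Finset.sum_le_sum fun j _ => (hpl j).trans ?_
    rw [hit, ← pow_mul, mul_comm 2 (m + 1)]
    refine mul_le_mul_of_nonneg_right ?_ (integral_nonneg (M.left_le_right j)
      fun _ _ => sq_nonneg _)
    exact pow_le_pow_left₀ (M.cellSize_pos j).le (M.cellSize_le_meshSize j) _
  have hdist : M.l2Dist v w = √(∑ j, ∫ x in (M.left j)..(M.right j), e j x ^ 2) := by
    rw [l2Dist]
    simp only [he, ← neg_sub (w _), neg_sq]
  rw [hdist]
  set Y := ∑ j, ∫ x in (M.left j)..(M.right j), e j x ^ 2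
  set X := ∑ j, ∫ x in (M.left j)..(M.right j), e' j x ^ 2
  rcases (Real.sqrt_nonneg Y).eq_or_lt with h0 | h0
  · rw [← h0]
    exact mul_nonneg (by positivity) (Real.sqrt_nonneg _)
  · have h1 : √Y * √Y ≤ √Y * (M.meshSize ^ 2 *
        (M.meshSize ^ (m + 1) * sobolevSeminorm a b (m + 3) w)) := by
      rw [Real.mul_self_sqrt hY]
      calc Y ≤ M.meshSize ^ 2 * X := hYX
        _ ≤ M.meshSize ^ 2 * (√Y * (M.meshSize ^ (m + 1) * sobolevSeminorm a b (m + 3) w)) := by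
            gcongr
            exact hXYZ.trans (by gcongr)
        _ = _ := by ring
    exact (le_of_mul_le_mul_left h1 h0).trans (le_of_eq (by ring))

/-- The piecewise polynomial with given coefficients. -/
noncomputable def ofCoeffs (n : ℕ) : (Fin M.N × Fin n → ℝ) →ₗ[ℝ] (Fin M.N → ℝ[X]) where
  toFun c j := ∑ i : Fin n, C (c (j, i)) * X ^ (i : ℕ)
  map_add' c d := by
    ext1 j
    simp [add_mul, Finset.sum_add_distrib]
  map_smul' s c := by
    ext1 j
    simp [Finset.smul_sum, smul_eq_C_mul, mul_assoc]

theorem coeff_ofCoeffs {n : ℕ} (c : Fin M.N × Fin n → ℝ) (j : Fin M.N) (i : Fin n) :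
    (M.ofCoeffs n c j).coeff i = c (j, i) := by
  simp only [ofCoeffs, LinearMap.coe_mk, AddHom.coe_mk, finsetSum_coeff, coeff_C_mul, coeff_X_pow]
  rw [Finset.sum_eq_single i]
  · simp
  · intro l _ hl
    simp [Fin.val_inj, hl.symm]
  · simp

theorem ofCoeffs_mem (k : ℕ) (c : Fin M.N × Fin (k + 1) → ℝ) :
    M.ofCoeffs (k + 1) c ∈ M.dgSpace k := by
  rw [mem_dgSpace]
  intro j
  change ∑ i : Fin (k + 1), C (c (j, i)) * X ^ (i : ℕ) ∈ degreeLE ℝ (k : WithBot ℕ)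
  refine Submodule.sum_mem _ fun i _ => ?_
  rw [mem_degreeLE]
  exact (degree_C_mul_X_pow_le _ _).trans (by exact_mod_cast Nat.lt_succ_iff.1 i.2)

/-- The data that determine the flux projection: averages of the value and of the derivative at the
right end point of each cell, and moments. -/
noncomputable def fluxData (m : ℕ) : (Fin M.N → ℝ[X]) →ₗ[ℝ] (Fin M.N × Fin (m + 3) → ℝ) where
  toFun v := fun ji => Fin.cases (M.avgRight v ji.1) (fun i => Fin.cases (M.avgRight (M.dx v) ji.1)
    (fun l => ∫ x in (M.left ji.1)..(M.right ji.1), (v ji.1).eval x * x ^ (l : ℕ)) i) ji.2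
  map_add' v w := by
    ext ⟨j, i⟩
    refine Fin.cases ?_ (fun i => Fin.cases ?_ (fun l => ?_) i) i
    · simp [avgRight, inRight, inLeft]
      ring
    · change M.avgRight (M.dx (v + w)) j = M.avgRight (M.dx v) j + M.avgRight (M.dx w) j
      simp [avgRight, inRight, inLeft, dx]
      ring
    · simp only [Fin.cases_succ, Pi.add_apply, eval_add]
      rw [← intervalIntegral.integral_add]
      · simp only [add_mul]
      all_goals exact Continuous.intervalIntegrable (by fun_prop) _ _
  map_smul' s v := by
    ext ⟨j, i⟩
    refine Fin.cases ?_ (fun i => Fin.cases ?_ (fun l => ?_) i) i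
    · simp [avgRight, inRight, inLeft]
      ring
    · change M.avgRight (M.dx (s • v)) j = s * M.avgRight (M.dx v) j
      simp [avgRight, inRight, inLeft, dx]
      ring
    · simp [mul_assoc]

/-- The data of a smooth function to be matched by its flux projection. -/
noncomputable def smoothData (m : ℕ) (w : ℝ → ℝ) : Fin M.N × Fin (m + 3) → ℝ :=
  fun ji => Fin.cases (w (M.right ji.1)) (fun i => Fin.cases (deriv w (M.right ji.1))
    (fun l => ∫ x in (M.left ji.1)..(M.right ji.1), w x * x ^ (l : ℕ)) i) ji.2

theorem commutesWithTimeDeriv_smoothData (m : ℕ) (ji : Fin M.N × Fin (m + 3)) :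
    CommutesWithTimeDeriv fun w => M.smoothData m w ji := by
  obtain ⟨j, i⟩ := ji
  refine Fin.cases ?_ (fun i => Fin.cases ?_ (fun l => ?_) i) i
  · exact commutesWithTimeDeriv_eval _
  · exact commutesWithTimeDeriv_deriv _
  · exact commutesWithTimeDeriv_integral _ _ (by fun_prop)

theorem flux_eq_of_fluxData_eq {m : ℕ} {v : Fin M.N → ℝ[X]} {w : ℝ → ℝ} (hw : Continuous w)
    (h : M.fluxData m v = M.smoothData m w) :
    (∀ j, M.avgRight v j = w (M.right j)) ∧ (∀ j, M.avgRight (M.dx v) j = deriv w (M.right j)) ∧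
      ∀ j, ∀ p ∈ degreeLE ℝ (m : WithBot ℕ),
        ∫ x in (M.left j)..(M.right j), (w x - (v j).eval x) * p.eval x = 0 := by
  refine ⟨fun j => congrFun h (j, 0), fun j => congrFun h (j, 1), fun j p hp => ?_⟩
  have hmono : ∀ l : Fin (m + 1),
      ∫ x in (M.left j)..(M.right j), (w x - (v j).eval x) * x ^ (l : ℕ) = 0 := by
    intro l
    have hl : ∫ x in (M.left j)..(M.right j), (v j).eval x * x ^ (l : ℕ)
        = ∫ x in (M.left j)..(M.right j), w x * x ^ (l : ℕ) := congrFun h (j, l.succ.succ)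
    simp only [sub_mul]
    rw [intervalIntegral.integral_sub, hl, sub_self]
    all_goals exact Continuous.intervalIntegrable (by fun_prop) _ _
  have hpn : p.natDegree < m + 1 := Nat.lt_succ_of_le
    (natDegree_le_of_degree_le (mem_degreeLE.1 hp))
  have hsum : ∀ x, (w x - (v j).eval x) * p.eval x
      = ∑ l : Fin (m + 1), p.coeff l * ((w x - (v j).eval x) * x ^ (l : ℕ)) := by
    intro x
    rw [eval_eq_sum_range' hpn, Finset.mul_sum,
      ← Fin.sum_univ_eq_sum_range (fun i => (w x - (v j).eval x) * (p.coeff i * x ^ i))]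
    exact Finset.sum_congr rfl fun l _ => by ring
  simp only [hsum]
  rw [intervalIntegral.integral_finsetSum]
  · simp [hmono]
  · exact fun l _ => Continuous.intervalIntegrable (by fun_prop) _ _

/-- A piecewise polynomial with zero data satisfies the hypotheses of `l2Dist_le_of_flux_eq` for w =
0, hence vanishes. Each cell carries m + 3 coefficients and m + 3 data, so injectivity of the square
system gives existence as well. -/
theorem fluxData_comp_ofCoeffs_injective (hab : a < b) (m : ℕ) :
    Function.Injective (M.fluxData m ∘ₗ M.ofCoeffs (m + 3)) := by
  rw [injective_iff_map_eq_zero]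
  intro c hc
  set v := M.ofCoeffs (m + 3) c with hv
  have hdata : M.fluxData m v = M.smoothData m fun _ => 0 := by
    refine (show M.fluxData m v = 0 from hc).trans ?_
    ext ⟨j, i⟩
    refine Fin.cases ?_ (fun i => Fin.cases ?_ (fun l => ?_) i) i
    · rfl
    · exact (deriv_const _ _).symm
    · simp [smoothData]
  obtain ⟨h0, h1, h2⟩ := M.flux_eq_of_fluxData_eq continuous_const hdata
  have h3 := M.l2Dist_le_of_flux_eq hab (M.ofCoeffs_mem (m + 2) c) contDiff_const
    (fun _ => rfl) h2 h0 h1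
  have h4 : sobolevSeminorm a b (m + 3) (fun _ => 0) = 0 := by
    simp [sobolevSeminorm]
  rw [h4, mul_zero, ← hv] at h3
  have h5 : ∑ j, ∫ x in (M.left j)..(M.right j), (v j).eval x ^ 2 = 0 := by
    have := Real.sqrt_eq_zero'.1 (le_antisymm h3 (M.l2Dist_nonneg _ _))
    simp only [sub_zero] at this
    exact le_antisymm this (M.sum_integral_sq_nonneg _)
  ext ⟨j, i⟩
  have h6 : ∫ x in (M.left j)..(M.right j), (v j).eval x ^ 2 = 0 :=
    (Finset.sum_eq_zero_iff_of_nonneg fun j _ => integral_nonneg (M.left_le_right j)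
      fun _ _ => sq_nonneg _).1 h5 j (Finset.mem_univ _)
  have h7 : v j = 0 := by
    refine eq_zero_of_infinite_isRoot _ ((Icc_infinite (M.left_lt_right j)).mono fun x hx => ?_)
    by_contra hne
    have hpos : 0 < ∫ x in (M.left j)..(M.right j), (v j).eval x ^ 2 :=
      intervalIntegral.integral_pos (M.left_lt_right j) (by fun_prop) (fun _ _ => sq_nonneg _)
        ⟨x, hx, by positivity [show (v j).eval x ≠ 0 from hne]⟩
    exact hpos.ne' h6
  have := M.coeff_ofCoeffs c j i
  rw [← hv, h7] at this
  simpa using this.symm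

end Mesh

theorem exists_isQuasiProjection_of_two_le {a b : ℝ} (hab : a < b) (M : Mesh a b) (m : ℕ) :
    ∃ P, IsQuasiProjection M (m + 2) 1 P := by
  have hinj := M.fluxData_comp_ofCoeffs_injective hab m
  set L := LinearEquiv.ofBijective _ ⟨hinj, LinearMap.injective_iff_surjective.1 hinj⟩ with hL
  set P : (ℝ → ℝ) → Fin M.N → ℝ[X] := fun w =>
    M.ofCoeffs (m + 3) (L.symm (M.smoothData m w)) with hP
  have hPw : ∀ w, M.fluxData m (P w) = M.smoothData m w := fun w =>
    L.apply_symm_apply (M.smoothData m w)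
  refine ⟨P, fun w => M.ofCoeffs_mem (m + 2) _, fun w hw hper => ?_, fun w hw hper φ hφ => ?_,
    fun j x => ?_⟩
  · obtain ⟨h0, h1, h2⟩ := M.flux_eq_of_fluxData_eq hw.continuous (hPw w)
    rw [one_mul]
    exact M.l2Dist_le_of_flux_eq hab (M.ofCoeffs_mem (m + 2) _) hw hper h2 h0 h1
  · obtain ⟨h0, h1, h2⟩ := M.flux_eq_of_fluxData_eq hw.continuous (hPw w)
    have hper' := periodic_deriv hper
    -- The fluxes are exact and φ_xx has degree at most m, so every term of the consistency identity
    -- vanishes.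
    have hzero : M.form (P w) φ
        + ∑ j, ∫ x in (M.left j)..(M.right j), iteratedDeriv 2 w x * (φ j).eval x = 0 := by
      rw [Mesh.form, ← Finset.sum_add_distrib]
      refine Finset.sum_eq_zero fun j _ => ?_
      rw [M.cellForm_add_integral hw, M.avgLeft_eq, M.avgLeft_eq, h0, h0, h1, h1,
        M.apply_right_prev hper, M.apply_right_prev hper', h2 j]
      · ring
      · have hφj := M.mem_dgSpace.1 hφ j
        rw [mem_degreeLE, degree_le_iff_coeff_zero] at hφj ⊢
        intro n hn
        have hn' : m < n := by exact_mod_cast hn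
        simp only [coeff_derivative]
        rw [hφj (n + 1 + 1) (by exact_mod_cast (by omega : m + 2 < n + 1 + 1))]
        simp
    rw [hzero, abs_zero]
    have := M.meshSize_pos hab
    exact mul_nonneg (mul_nonneg (by positivity) (Real.sqrt_nonneg _)) (M.norm_nonneg _)
  -- Point values of P w depend linearly on finitely many data of w, each of which commutes with the
  -- time derivative.
  · set Λ : (Fin M.N × Fin (m + 3) → ℝ) →ₗ[ℝ] ℝ :=
      (leval x) ∘ₗ (LinearMap.proj j) ∘ₗ (M.ofCoeffs (m + 3)) ∘ₗ L.symm.toLinearMap with hΛ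
    have h1 : (fun w => (P w j).eval x)
        = fun w => ∑ i, M.smoothData m w i * Λ (fun l => if i = l then 1 else 0) := by
      ext w
      exact Λ.pi_apply_eq_sum_univ (M.smoothData m w)
    rw [h1]
    exact CommutesWithTimeDeriv.sum fun i =>
      (M.commutesWithTimeDeriv_smoothData m i).mul_const _

/-! ### Piecewise linear functions on uniform meshes -/

theorem abs_symm_diff_le {f : ℝ → ℝ} (hf : ContDiff ℝ (⊤ : ℕ∞) f) {x h S : ℝ} (hh : 0 ≤ h)
    (hS : ∀ z ∈ Icc (x - h) (x + h), |deriv (deriv f) z| ≤ S) :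
    |f (x + h) + f (x - h) - 2 * f x| ≤ 2 * h ^ 2 * S := by
  have hf' : ContDiff ℝ (⊤ : ℕ∞) (deriv f) := (contDiff_infty_iff_deriv.1 hf).2
  have d0 : ∀ z, HasDerivAt f (deriv f z) z := fun z => (hf.differentiable (by simp) z).hasDerivAt
  have hS0 : 0 ≤ S := (abs_nonneg _).trans (hS x ⟨by linarith, by linarith⟩)
  have h1 : ∀ s ∈ Icc 0 h, |deriv f (x + s) - deriv f (x - s)| ≤ S * (2 * h) := by
    intro s hs
    have := (convex_Icc (x - h) (x + h)).norm_image_sub_le_of_norm_deriv_le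
      (f := deriv f) (fun z _ => hf'.differentiable (by simp) z) hS
      (x := x - s) (y := x + s) ⟨by linarith [hs.2], by linarith [hs.1]⟩
      ⟨by linarith [hs.1], by linarith [hs.2]⟩
    refine this.trans (mul_le_mul_of_nonneg_left ?_ hS0)
    rw [Real.norm_eq_abs, abs_of_nonneg (by linarith [hs.1])]
    linarith [hs.2]
  have h2 : ∀ s ∈ Icc 0 h, HasDerivWithinAt (fun s => f (x + s) + f (x - s))
      (deriv f (x + s) - deriv f (x - s)) (Icc 0 h) s := fun s _ => by
    have := ((d0 (x + s)).comp_const_add x s).add ((d0 (x - s)).comp_const_sub x s)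
    exact this.hasDerivWithinAt
  have h3 := (convex_Icc 0 h).norm_image_sub_le_of_norm_hasDerivWithin_le h2 h1
    (left_mem_Icc.2 hh) (right_mem_Icc.2 hh)
  simp only [Real.norm_eq_abs, add_zero, sub_zero, abs_of_nonneg hh] at h3
  rw [two_mul]
  exact h3.trans (le_of_eq (by ring))

/-- The nodal correction that turns the piecewise linear interpolant on a uniform mesh of size `h`
into a quasi-projection. -/
noncomputable def nodalCorrection (h : ℝ) (w : ℝ → ℝ) (x : ℝ) : ℝ :=
  (2 * h * deriv w x - w (x + h) + w (x - h)) / 4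

theorem hasDerivAt_nodalCorrection (h : ℝ) {w : ℝ → ℝ} (hw : ContDiff ℝ (⊤ : ℕ∞) w) (x : ℝ) :
    HasDerivAt (nodalCorrection h w) (nodalCorrection h (deriv w) x) x := by
  have hw' : ContDiff ℝ (⊤ : ℕ∞) (deriv w) := (contDiff_infty_iff_deriv.1 hw).2
  have d0 : ∀ z, HasDerivAt w (deriv w z) z := fun z => (hw.differentiable (by simp) z).hasDerivAt
  have d1 : HasDerivAt (deriv w) (deriv (deriv w) x) x :=
    (hw'.differentiable (by simp) x).hasDerivAt
  exact (((d1.const_mul (2 * h)).sub ((d0 (x + h)).comp_add_const x h)).add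
    ((d0 (x - h)).comp_sub_const x h)).div_const 4

theorem contDiff_nodalCorrection (h : ℝ) {w : ℝ → ℝ} (hw : ContDiff ℝ (⊤ : ℕ∞) w) :
    ContDiff ℝ (⊤ : ℕ∞) (nodalCorrection h w) := by
  have hw' : ContDiff ℝ (⊤ : ℕ∞) (deriv w) := (contDiff_infty_iff_deriv.1 hw).2
  unfold nodalCorrection
  fun_prop

theorem periodic_nodalCorrection (h : ℝ) {w : ℝ → ℝ} {c : ℝ} (hw : Function.Periodic w c) :
    Function.Periodic (nodalCorrection h w) c := fun x => by
  have h1 := periodic_deriv hw x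
  have h2 := hw (x + h)
  have h3 := hw (x - h)
  rw [add_right_comm] at h2
  rw [← add_sub_right_comm] at h3
  simp only [nodalCorrection, h1, h2, h3]

theorem commutesWithTimeDeriv_nodalCorrection (h x : ℝ) :
    CommutesWithTimeDeriv fun w => nodalCorrection h w x := by
  have h1 := (((commutesWithTimeDeriv_deriv x).mul_const (h / 2)).add
    ((commutesWithTimeDeriv_eval (x + h)).mul_const (-1 / 4))).add
    ((commutesWithTimeDeriv_eval (x - h)).mul_const (1 / 4))
  convert h1 using 2
  rw [nodalCorrection]
  ring

/-- As a function of s, the numerator 2s w'(x) - w(x+s) + w(x-s) vanishes at 0, and its derivative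
is a sum of two differences of w' over distance at most h. Each is bounded by √(2hD), with D the
local integral of (w'')². -/
theorem nodalCorrection_sq_le {h : ℝ} (hh : 0 ≤ h) {w : ℝ → ℝ} (hw : ContDiff ℝ (⊤ : ℕ∞) w)
    {x c d : ℝ} (hc : c ≤ x - h) (hd : x + h ≤ d) :
    nodalCorrection h w x ^ 2 ≤ h ^ 3 / 2 * ∫ z in c..d, iteratedDeriv 2 w z ^ 2 := by
  have hw' : ContDiff ℝ (⊤ : ℕ∞) (deriv w) := (contDiff_infty_iff_deriv.1 hw).2
  have hc2 := continuous_iteratedDeriv hw 2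
  have e2 : iteratedDeriv 2 w = deriv (deriv w) := by
    rw [iteratedDeriv_succ, iteratedDeriv_one]
  have d0 : ∀ z, HasDerivAt w (deriv w z) z := fun z => (hw.differentiable (by simp) z).hasDerivAt
  set D := ∫ z in (x - h)..(x + h), iteratedDeriv 2 w z ^ 2 with hD
  have hD0 : 0 ≤ D := integral_nonneg (by linarith) fun _ _ => sq_nonneg _
  have hDD : D ≤ ∫ z in c..d, iteratedDeriv 2 w z ^ 2 := integral_sq_mono hc (by linarith) hd hc2
  have h1 : ∀ z ∈ Icc (x - h) (x + h), |deriv w z - deriv w x| ≤ √(2 * h * D) := by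
    intro z hz
    have := sq_sub_le (hw'.of_le (by exact_mod_cast le_top))
      (show x ∈ Icc (x - h) (x + h) from ⟨by linarith, by linarith⟩) hz
    rw [← e2, ← hD] at this
    exact Real.abs_le_sqrt (this.trans (le_of_eq (by ring)))
  have h2 : ∀ s ∈ Icc 0 h, HasDerivWithinAt (fun s => 2 * s * deriv w x - w (x + s) + w (x - s))
      (2 * deriv w x - deriv w (x + s) - deriv w (x - s)) (Icc 0 h) s := fun s _ => by
    have := (((((hasDerivAt_id s).const_mul 2).mul_const (deriv w x)).sub
      ((d0 (x + s)).comp_const_add x s)).add ((d0 (x - s)).comp_const_sub x s)).congr_deriv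
      (show _ = 2 * deriv w x - deriv w (x + s) - deriv w (x - s) by ring)
    exact this.hasDerivWithinAt
  have h3 : ∀ s ∈ Icc 0 h, ‖2 * deriv w x - deriv w (x + s) - deriv w (x - s)‖
      ≤ 2 * √(2 * h * D) := by
    intro s hs
    have e1 := abs_le.1 (h1 (x + s) ⟨by linarith [hs.1], by linarith [hs.2]⟩)
    have e2 := abs_le.1 (h1 (x - s) ⟨by linarith [hs.2], by linarith [hs.1]⟩)
    rw [Real.norm_eq_abs, abs_le]
    constructor <;> linarith [e1.1, e1.2, e2.1, e2.2]
  have h4 := (convex_Icc 0 h).norm_image_sub_le_of_norm_hasDerivWithin_le h2 h3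
    (left_mem_Icc.2 hh) (right_mem_Icc.2 hh)
  simp only [Real.norm_eq_abs, sub_zero, abs_of_nonneg hh] at h4
  have h5 : |nodalCorrection h w x| ≤ h / 2 * √(2 * h * D) := by
    rw [nodalCorrection, abs_div, abs_of_pos (by norm_num : (0 : ℝ) < 4)]
    simp only [mul_zero, zero_mul, add_zero, sub_zero, zero_sub, neg_add_cancel] at h4
    linarith
  have h6 := pow_le_pow_left₀ (abs_nonneg _) h5 2
  rw [sq_abs, mul_pow, Real.sq_sqrt (by positivity)] at h6
  refine h6.trans ?_
  calc (h / 2) ^ 2 * (2 * h * D) = h ^ 3 / 2 * D := by ring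
    _ ≤ _ := by gcongr

/-- The correction commutes with differentiation in x, so its second derivative is the correction of
w'', to which `nodalCorrection_sq_le` applies. The second difference contributes the further factor
h². -/
theorem nodalCorrection_symm_diff_sq_le {h : ℝ} (hh : 0 ≤ h) {w : ℝ → ℝ}
    (hw : ContDiff ℝ (⊤ : ℕ∞) w) {x c d : ℝ} (hc : c ≤ x - 2 * h) (hd : x + 2 * h ≤ d) :
    (nodalCorrection h w (x + h) + nodalCorrection h w (x - h) - 2 * nodalCorrection h w x) ^ 2
      ≤ 2 * h ^ 7 * ∫ z in c..d, iteratedDeriv 4 w z ^ 2 := by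
  have hw' : ContDiff ℝ (⊤ : ℕ∞) (deriv w) := (contDiff_infty_iff_deriv.1 hw).2
  have hw'' : ContDiff ℝ (⊤ : ℕ∞) (deriv (deriv w)) := (contDiff_infty_iff_deriv.1 hw').2
  have e4 : iteratedDeriv 4 w = iteratedDeriv 2 (deriv (deriv w)) := by
    rw [← iteratedDeriv_succ', ← iteratedDeriv_succ']
  have hd1 : deriv (nodalCorrection h w) = nodalCorrection h (deriv w) :=
    funext fun z => (hasDerivAt_nodalCorrection h hw z).deriv
  have hd2 : deriv (nodalCorrection h (deriv w)) = nodalCorrection h (deriv (deriv w)) :=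
    funext fun z => (hasDerivAt_nodalCorrection h hw' z).deriv
  have hI : 0 ≤ ∫ z in c..d, iteratedDeriv 4 w z ^ 2 :=
    integral_nonneg (by linarith) fun _ _ => sq_nonneg _
  have h1 := abs_symm_diff_le (contDiff_nodalCorrection h hw) (x := x) hh
    (S := √(h ^ 3 / 2 * ∫ z in c..d, iteratedDeriv 4 w z ^ 2)) fun z hz => by
      rw [hd1, hd2, e4]
      exact Real.abs_le_sqrt (nodalCorrection_sq_le hh hw'' (by linarith [hz.1])
        (by linarith [hz.2]))
  have h2 := pow_le_pow_left₀ (abs_nonneg _) h1 2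
  rw [sq_abs, mul_pow, Real.sq_sqrt (by positivity)] at h2
  exact h2.trans (le_of_eq (by ring))

/-- The linear polynomial with value `p` at `l` and value `q` at `r`. -/
noncomputable def linearPoly (l r p q : ℝ) : ℝ[X] := C p + C ((q - p) / (r - l)) * (X - C l)

theorem eval_linearPoly (l r p q x : ℝ) :
    (linearPoly l r p q).eval x = p + (q - p) / (r - l) * (x - l) := by
  simp [linearPoly]

theorem derivative_linearPoly (l r p q : ℝ) :
    derivative (linearPoly l r p q) = C ((q - p) / (r - l)) := by
  simp [linearPoly]

theorem linearPoly_mem (l r p q : ℝ) : linearPoly l r p q ∈ degreeLE ℝ ((1 : ℕ) : WithBot ℕ) := by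
  rw [mem_degreeLE, linearPoly]
  exact (degree_linear_le (a := (q - p) / (r - l)) (b := p - (q - p) / (r - l) * l)).trans' <|
    le_of_eq (congrArg degree (by simp; ring))

theorem integral_linear_sq (l r c s : ℝ) :
    ∫ x in l..r, (c + s * x) ^ 2
      = c ^ 2 * (r - l) + c * s * (r ^ 2 - l ^ 2) + s ^ 2 * (r ^ 3 - l ^ 3) / 3 := by
  have : ∀ x ∈ uIcc l r, HasDerivAt (fun x : ℝ => c ^ 2 * x + c * s * x ^ 2 + s ^ 2 * x ^ 3 / 3)
      ((c + s * x) ^ 2) x := fun x _ => by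
    have := (((hasDerivAt_id x).const_mul (c ^ 2)).add
      ((hasDerivAt_pow 2 x).const_mul (c * s))).add
      (((hasDerivAt_pow 3 x).const_mul (s ^ 2)).div_const 3)
    refine this.congr_deriv ?_
    simp
    ring
  rw [integral_eq_sub_of_hasDerivAt this (Continuous.intervalIntegrable (by fun_prop) _ _)]
  ring

/-- Discrete trace inequality, used to bound the end values of linear test functions by their L²
norm. -/
theorem eval_sq_le_of_mem_degreeLE_one {p : ℝ[X]} (hp : p ∈ degreeLE ℝ ((1 : ℕ) : WithBot ℕ))
    {l r : ℝ} (hlr : l ≤ r) :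
    (r - l) * p.eval l ^ 2 ≤ 4 * ∫ x in l..r, p.eval x ^ 2 ∧
      (r - l) * p.eval r ^ 2 ≤ 4 * ∫ x in l..r, p.eval x ^ 2 := by
  have hpe : ∀ x, p.eval x = p.coeff 0 + p.coeff 1 * x := by
    intro x
    have := eq_X_add_C_of_degree_le_one (mem_degreeLE.1 hp)
    conv_lhs => rw [this]
    simp
    ring
  simp only [hpe, integral_linear_sq]
  have hd := sub_nonneg.2 hlr
  constructor
  -- The two sides differ by exactly a third of this term; the square is that of p(l) + 2p(r).
  · nlinarith [mul_nonneg hd (sq_nonneg (3 * (p.coeff 0) + p.coeff 1 * (l + 2 * r)))]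
  · nlinarith [mul_nonneg hd (sq_nonneg (3 * (p.coeff 0) + p.coeff 1 * (r + 2 * l)))]

namespace Mesh

variable {a b : ℝ} (M : Mesh a b)

theorem IsUniform.right_sub_left {M : Mesh a b} (hM : M.IsUniform) (j : Fin M.N) :
    M.right j - M.left j = M.meshSize := by
  have : Nonempty (Fin M.N) := ⟨j⟩
  have h : ∀ i, M.cellSize i = M.cellSize j := fun i => hM i j
  rw [meshSize, funext h, ciSup_const]
  rfl

theorem sum_integral_add {g : ℝ → ℝ} (hg : Continuous g) (hper : Function.Periodic g (b - a))
    (s : ℝ) : ∑ j, ∫ x in (M.left j + s)..(M.right j + s), g x = ∫ x in a..b, g x := by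
  have h1 := M.sum_integral (f := fun x => g (x + s)) (by fun_prop)
  simp only [integral_comp_add_right] at h1
  rw [h1]
  have h2 := hper.intervalIntegral_add_eq (a + s) a
  rw [show a + s + (b - a) = b + s by ring, show a + (b - a) = b by ring] at h2
  exact h2

/-- Each patch is the union of five translates of its cell by multiples of h, and the translates of
all cells by a fixed amount cover one period. -/
theorem IsUniform.sum_integral_patch {M : Mesh a b} (hM : M.IsUniform) {g : ℝ → ℝ}
    (hg : Continuous g) (hper : Function.Periodic g (b - a)) :
    ∑ j, ∫ x in (M.left j - 2 * M.meshSize)..(M.right j + 2 * M.meshSize), g x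
      = 5 * ∫ x in a..b, g x := by
  have h1 : ∀ j, ∫ x in (M.left j - 2 * M.meshSize)..(M.right j + 2 * M.meshSize), g x
      = ∑ i ∈ Finset.range 5, ∫ x in (M.left j + ((i : ℝ) - 2) * M.meshSize)..(M.right j
        + ((i : ℝ) - 2) * M.meshSize), g x := by
    intro j
    have h2 := sum_integral_adjacent_intervals (f := g) (μ := MeasureTheory.volume) (n := 5)
      (a := fun i : ℕ => M.left j + ((i : ℝ) - 2) * M.meshSize)
      (fun i _ => hg.intervalIntegrable _ _)
    have h3 := hM.right_sub_left j
    have e1 : M.left j + (((0 : ℕ) : ℝ) - 2) * M.meshSize = M.left j - 2 * M.meshSize := by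
      push_cast
      ring
    have e2 : M.left j + (((5 : ℕ) : ℝ) - 2) * M.meshSize = M.right j + 2 * M.meshSize := by
      push_cast
      linarith
    rw [e1, e2] at h2
    rw [← h2]
    refine Finset.sum_congr rfl fun i _ => ?_
    congr 1
    push_cast
    linarith
  simp only [h1]
  rw [Finset.sum_comm]
  simp only [M.sum_integral_add hg hper]
  simp

/-- The corrected piecewise linear interpolant. -/
noncomputable def linearQuasiProjection (w : ℝ → ℝ) (j : Fin M.N) : ℝ[X] :=
  linearPoly (M.left j) (M.right j) (w (M.left j) - nodalCorrection M.meshSize w (M.left j))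
    (w (M.right j) + nodalCorrection M.meshSize w (M.right j))

theorem linearQuasiProjection_left (w : ℝ → ℝ) (j : Fin M.N) :
    M.inLeft (M.linearQuasiProjection w) j
      = w (M.left j) - nodalCorrection M.meshSize w (M.left j) := by
  simp [inLeft, linearQuasiProjection, eval_linearPoly]

theorem linearQuasiProjection_right (w : ℝ → ℝ) (j : Fin M.N) :
    M.inRight (M.linearQuasiProjection w) j
      = w (M.right j) + nodalCorrection M.meshSize w (M.right j) := by
  rw [inRight, linearQuasiProjection, eval_linearPoly,
    div_mul_cancel₀ _ (sub_pos.2 (M.left_lt_right j)).ne']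
  ring

theorem IsUniform.l2Dist_linearQuasiProjection_le {M : Mesh a b} (hab : a < b)
    (hM : M.IsUniform) {w : ℝ → ℝ} (hw : ContDiff ℝ (⊤ : ℕ∞) w)
    (hper : Function.Periodic w (b - a)) :
    M.l2Dist (M.linearQuasiProjection w) w
      ≤ 7 * M.meshSize ^ 2 * sobolevSeminorm a b 2 w := by
  have hh := M.meshSize_pos hab
  set h := M.meshSize with hdef
  have hw' : ContDiff ℝ (⊤ : ℕ∞) (deriv w) := (contDiff_infty_iff_deriv.1 hw).2
  have hc2 := continuous_iteratedDeriv hw 2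
  have e2 : iteratedDeriv 2 w = deriv (deriv w) := by
    rw [iteratedDeriv_succ, iteratedDeriv_one]
  have hper2 : Function.Periodic (fun x => iteratedDeriv 2 w x ^ 2) (b - a) := fun x => by
    simp only [e2, periodic_deriv (periodic_deriv hper) x]
  have hcell : ∀ j, ∫ x in (M.left j)..(M.right j), ((M.linearQuasiProjection w j).eval x - w x) ^ 2
      ≤ 4 * h ^ 4 * ∫ x in (M.left j - 2 * h)..(M.right j + 2 * h), iteratedDeriv 2 w x ^ 2 := by
    intro j
    set l := M.left j with hl
    set r := M.right j with hr
    have hlr : l < r := M.left_lt_right j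
    have hrl : r - l = h := hM.right_sub_left j
    set D := ∫ x in (l - 2 * h)..(r + 2 * h), iteratedDeriv 2 w x ^ 2 with hD
    set I := linearPoly l r (w l) (w r) with hI
    set J := linearPoly l r (- nodalCorrection h w l) (nodalCorrection h w r) with hJ
    have hsplit : ∀ x, (M.linearQuasiProjection w j).eval x - w x = J.eval x - (w x - I.eval x) := by
      intro x
      simp only [linearQuasiProjection, hI, hJ, eval_linearPoly]
      ring
    have hf : ContDiff ℝ 1 fun x => w x - I.eval x :=
      (hw.of_le (by exact_mod_cast le_top)).sub (contDiff_eval I)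
    have hfd : deriv (fun x => w x - I.eval x) = fun x => deriv w x - (w r - w l) / (r - l) := by
      ext x
      rw [deriv_fun_sub (hw.differentiable (by simp) x) (Polynomial.differentiable _ x), deriv_eval,
        hI, derivative_linearPoly]
      beta_reduce
      rw [eval_C]
    -- Two Poincaré steps: the interpolation error vanishes at l, and its derivative has mean zero.
    have hIb : ∫ x in l..r, (w x - I.eval x) ^ 2 ≤ h ^ 4 * D := by
      have h1 := integral_sq_le_of_eq_zero hf (left_mem_Icc.2 hlr.le) (by simp [hI, eval_linearPoly])
      have h2 : ∫ x in l..r, (deriv w x - (w r - w l) / (r - l)) = 0 := by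
        rw [intervalIntegral.integral_sub (hw'.continuous.intervalIntegrable _ _)
          intervalIntegrable_const, integral_deriv_eq_sub
          (fun x _ => hw.differentiable (by simp) x) (hw'.continuous.intervalIntegrable _ _)]
        simp only [intervalIntegral.integral_const, smul_eq_mul]
        rw [mul_div_cancel₀ _ (sub_pos.2 hlr).ne', sub_self]
      have h3 := integral_sq_le_of_integral_eq_zero hlr
        ((hw'.of_le (by exact_mod_cast le_top)).sub contDiff_const) h2
      have h4 : deriv (fun x => deriv w x - (w r - w l) / (r - l)) = iteratedDeriv 2 w := by
        ext x
        rw [deriv_sub_const, e2]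
      rw [h4] at h3
      rw [hfd, hrl] at h1
      rw [hrl] at h3
      have h5 : ∫ x in l..r, iteratedDeriv 2 w x ^ 2 ≤ D :=
        integral_sq_mono (by linarith) hlr.le (by linarith) hc2
      calc _ ≤ _ := h1
        _ ≤ h ^ 2 * (h ^ 2 * ∫ x in l..r, iteratedDeriv 2 w x ^ 2) := by
            gcongr
        _ ≤ h ^ 2 * (h ^ 2 * D) := by gcongr
        _ = h ^ 4 * D := by ring
    have hJb : ∫ x in l..r, J.eval x ^ 2 ≤ h ^ 4 * D := by
      have h1 := nodalCorrection_sq_le hh.le hw (x := l) (c := l - 2 * h) (d := r + 2 * h)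
        (by linarith) (by linarith)
      have h2 := nodalCorrection_sq_le hh.le hw (x := r) (c := l - 2 * h) (d := r + 2 * h)
        (by linarith) (by linarith)
      refine (integral_sq_le_of_forall_le (K := h ^ 3 * D) hlr.le (by fun_prop)
        fun x hx => ?_).trans (le_of_eq ?_)
      · set p := nodalCorrection h w l
        set q := nodalCorrection h w r
        have h3 : J.eval x = -(1 - (x - l) / h) * p + (x - l) / h * q := by
          rw [hJ, eval_linearPoly, hrl]
          ring
        have h4 : 0 ≤ (x - l) / h := div_nonneg (by linarith [hx.1]) hh.le
        have h5 : (x - l) / h ≤ 1 := (div_le_one hh).2 (by linarith [hx.2])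
        rw [h3]
        set θ := (x - l) / h
        have h6 : (-(1 - θ) * p + θ * q) ^ 2 ≤ p ^ 2 + q ^ 2 := by
          nlinarith [mul_nonneg (mul_nonneg h4 (sub_nonneg.2 h5)) (sq_nonneg (p + q)),
            mul_nonneg h4 (sq_nonneg p), mul_nonneg (sub_nonneg.2 h5) (sq_nonneg q)]
        linarith
      · rw [hrl]
        ring
    calc ∫ x in l..r, ((M.linearQuasiProjection w j).eval x - w x) ^ 2
        ≤ ∫ x in l..r, (2 * J.eval x ^ 2 + 2 * (w x - I.eval x) ^ 2) := by
          refine integral_mono_on hlr.le ?_ ?_ fun x _ => ?_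
          · have := hw.continuous
            exact Continuous.intervalIntegrable (by fun_prop) _ _
          · have := hw.continuous
            exact Continuous.intervalIntegrable (by fun_prop) _ _
          · rw [hsplit]
            nlinarith [sq_nonneg (J.eval x + (w x - I.eval x))]
      _ = 2 * (∫ x in l..r, J.eval x ^ 2) + 2 * ∫ x in l..r, (w x - I.eval x) ^ 2 := by
          have := hw.continuous
          rw [← intervalIntegral.integral_const_mul, ← intervalIntegral.integral_const_mul,
            ← intervalIntegral.integral_add]
          all_goals exact Continuous.intervalIntegrable (by fun_prop) _ _
      _ ≤ 4 * h ^ 4 * D := by linarith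
  refine Real.sqrt_le_iff.2 ⟨mul_nonneg (by positivity) (Real.sqrt_nonneg _), ?_⟩
  have hnn : 0 ≤ ∫ x in a..b, iteratedDeriv 2 w x ^ 2 :=
    integral_nonneg hab.le fun _ _ => sq_nonneg _
  rw [mul_pow, sobolevSeminorm, Real.sq_sqrt hnn]
  refine (Finset.sum_le_sum fun j _ => hcell j).trans ?_
  rw [← Finset.mul_sum, hM.sum_integral_patch (by fun_prop) hper2]
  nlinarith [mul_nonneg (pow_nonneg hh.le 4) hnn]

/-- The average of the two slopes at a node x is [w(x+h) - w(x-h) + 2y(x) + y(x+h) + y(x-h)]/(2h).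
By the definition of y, w(x+h) - w(x-h) + 4y(x) = 2h w'(x), so the error is the second difference of
y over 2h, up to sign. -/
theorem IsUniform.sub_avgRight_sq_le {M : Mesh a b} (hab : a < b)
    (hM : M.IsUniform) {w : ℝ → ℝ} (hw : ContDiff ℝ (⊤ : ℕ∞) w)
    (hper : Function.Periodic w (b - a)) (j : Fin M.N) {c d : ℝ}
    (hc : c ≤ M.right j - 2 * M.meshSize) (hd : M.right j + 2 * M.meshSize ≤ d) :
    (deriv w (M.right j) - M.avgRight (M.dx (M.linearQuasiProjection w)) j) ^ 2
      ≤ M.meshSize ^ 5 / 2 * ∫ z in c..d, iteratedDeriv 4 w z ^ 2 := by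
  have hh := M.meshSize_pos hab
  set h := M.meshSize with hdef
  have h1 := nodalCorrection_symm_diff_sq_le hh.le hw hc hd
  have hl : ∀ i, M.left i = M.right i - h := fun i => by linarith [hM.right_sub_left i]
  have hr : M.right (M.next j) = M.left (M.next j) + h := by
    linarith [hM.right_sub_left (M.next j)]
  have pw := M.apply_left_next hper j
  have py := M.apply_left_next (periodic_nodalCorrection h hper) j
  have pw' : w (M.right (M.next j)) = w (M.right j + h) := by
    rw [hr]
    exact M.apply_left_next (w := fun x => w (x + h))
      (fun x => by simp only [add_right_comm x (b - a) h, hper (x + h)]) j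
  have py' : nodalCorrection h w (M.right (M.next j)) = nodalCorrection h w (M.right j + h) := by
    rw [hr]
    exact M.apply_left_next (w := fun x => nodalCorrection h w (x + h)) (fun x => by
      simp only [add_right_comm x (b - a) h, periodic_nodalCorrection h hper (x + h)]) j
  have h2 : deriv w (M.right j) - M.avgRight (M.dx (M.linearQuasiProjection w)) j
      = -(nodalCorrection h w (M.right j + h) + nodalCorrection h w (M.right j - h)
        - 2 * nodalCorrection h w (M.right j)) / (2 * h) := by
    have h3 : 4 * nodalCorrection h w (M.right j) = 2 * h * deriv w (M.right j)
        - w (M.right j + h) + w (M.right j - h) := by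
      rw [nodalCorrection]
      ring
    simp only [avgRight, inRight, inLeft, dx, linearQuasiProjection, derivative_linearPoly, eval_C,
      ← hdef, hM.right_sub_left, pw, py, pw', py']
    rw [hl j]
    field_simp
    linarith
  rw [h2, div_pow, neg_sq, div_le_iff₀ (by positivity)]
  exact h1.trans (le_of_eq (by ring))

/-- Here φ_xx = 0 and {P w} is exact, so only the errors of {(P w)_x} remain. They are of size
h^{5/2}, the trace inequality costs h^{-1/2}, and Cauchy–Schwarz over the cells gives h². -/
theorem IsUniform.abs_form_linearQuasiProjection_add_le {M : Mesh a b} (hab : a < b)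
    (hM : M.IsUniform) {w : ℝ → ℝ} (hw : ContDiff ℝ (⊤ : ℕ∞) w)
    (hper : Function.Periodic w (b - a)) {φ : Fin M.N → ℝ[X]} (hφ : φ ∈ M.dgSpace 1) :
    |M.form (M.linearQuasiProjection w) φ
        + ∑ j, ∫ x in (M.left j)..(M.right j), iteratedDeriv 2 w x * (φ j).eval x|
      ≤ 7 * M.meshSize ^ 2 * sobolevSeminorm a b 4 w * M.norm φ := by
  have hh := M.meshSize_pos hab
  set h := M.meshSize with hdef
  set v := M.linearQuasiProjection w with hv
  have hc4 := continuous_iteratedDeriv hw 4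
  have hper4 : Function.Periodic (fun x => iteratedDeriv 4 w x ^ 2) (b - a) := fun x => by
    have e4 : iteratedDeriv 4 w = deriv (deriv (deriv (deriv w))) := by
      simp only [iteratedDeriv_succ, iteratedDeriv_zero]
    simp only [e4, periodic_deriv (periodic_deriv (periodic_deriv (periodic_deriv hper))) x]
  set D : Fin M.N → ℝ := fun j =>
    ∫ x in (M.left j - 2 * h)..(M.right j + 2 * h), iteratedDeriv 4 w x ^ 2 with hD
  set F : Fin M.N → ℝ := fun j => ∫ x in (M.left j)..(M.right j), (φ j).eval x ^ 2 with hF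
  have hD0 : ∀ j, 0 ≤ D j := fun j => integral_nonneg (by linarith [M.left_lt_right j])
    fun _ _ => sq_nonneg _
  have hF0 : ∀ j, 0 ≤ F j := fun j => integral_nonneg (M.left_le_right j) fun _ _ => sq_nonneg _
  have hval : ∀ j, M.avgRight v j = w (M.right j) := by
    intro j
    rw [avgRight, hv, linearQuasiProjection_right, linearQuasiProjection_left,
      M.apply_left_next hper, M.apply_left_next (periodic_nodalCorrection _ hper)]
    ring
  have hbound : ∀ ρ s d f : ℝ, 0 ≤ d → 0 ≤ f → ρ ^ 2 ≤ h ^ 5 / 2 * d → h * s ^ 2 ≤ 4 * f →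
      |ρ * s| ≤ √2 * h ^ 2 * (√d * √f) := by
    intro ρ s d f hd hf h1 h2
    have h3 : (ρ * s) ^ 2 ≤ 2 * (h ^ 2) ^ 2 * (d * f) := by
      have h4 : s ^ 2 ≤ 4 * f / h := by
        rw [le_div_iff₀ hh]
        linarith
      calc (ρ * s) ^ 2 = ρ ^ 2 * s ^ 2 := by ring
        _ ≤ (h ^ 5 / 2 * d) * (4 * f / h) := by gcongr
        _ = 2 * (h ^ 2) ^ 2 * (d * f) := by
          field_simp
          ring
    have h5 := Real.abs_le_sqrt h3
    rwa [Real.sqrt_mul (by positivity), Real.sqrt_mul (by positivity),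
      Real.sqrt_sq (by positivity), Real.sqrt_mul hd] at h5
  have hcell : ∀ j, |M.cellForm v φ j
      + ∫ x in (M.left j)..(M.right j), iteratedDeriv 2 w x * (φ j).eval x|
      ≤ 2 * √2 * h ^ 2 * (√(D j) * √(F j)) := by
    intro j
    have hφj := M.mem_dgSpace.1 hφ j
    have hφ2 : derivative (derivative (φ j)) = 0 := by
      rw [eq_X_add_C_of_degree_le_one (mem_degreeLE.1 hφj)]
      simp
    have hrl := hM.right_sub_left j
    obtain ⟨hfl, hfr⟩ := eval_sq_le_of_mem_degreeLE_one hφj (M.left_le_right j)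
    rw [hrl] at hfl hfr
    have hR := hbound _ _ (D j) (F j) (hD0 j) (hF0 j)
      (hM.sub_avgRight_sq_le hab hw hper j (c := M.left j - 2 * h) (d := M.right j + 2 * h)
        (by linarith [M.left_lt_right j]) le_rfl) hfr
    have hLsq : (deriv w (M.left j) - M.avgLeft (M.dx v) j) ^ 2 ≤ h ^ 5 / 2 * D j := by
      rw [M.avgLeft_eq, ← M.apply_right_prev (periodic_deriv hper)]
      refine (hM.sub_avgRight_sq_le hab hw hper (M.prev j) le_rfl le_rfl).trans ?_
      -- The right end of the previous cell may be b while the left end of this one is a; both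
      -- integrals are written relative to their centres and compared by periodicity.
      have hle : ∫ z in (M.right (M.prev j) - 2 * h)..(M.right (M.prev j) + 2 * h),
          iteratedDeriv 4 w z ^ 2 ≤ D j := by
        have hq : ∀ i, ∫ z in (M.right i - 2 * h)..(M.right i + 2 * h), iteratedDeriv 4 w z ^ 2
            = ∫ z in (-2 * h)..(2 * h), iteratedDeriv 4 w (M.right i + z) ^ 2 := fun i => by
          rw [integral_comp_add_left (fun z => iteratedDeriv 4 w z ^ 2)]
          congr 1
          ring
        have hq' : ∫ z in (M.left j - 2 * h)..(M.left j + 2 * h), iteratedDeriv 4 w z ^ 2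
            = ∫ z in (-2 * h)..(2 * h), iteratedDeriv 4 w (M.left j + z) ^ 2 := by
          rw [integral_comp_add_left (fun z => iteratedDeriv 4 w z ^ 2)]
          congr 1
          ring
        have hqe : ∀ z, iteratedDeriv 4 w (M.right (M.prev j) + z) ^ 2
            = iteratedDeriv 4 w (M.left j + z) ^ 2 := fun z =>
          M.apply_right_prev (w := fun x => iteratedDeriv 4 w (x + z) ^ 2) (fun x => by
            have := hper4 (x + z)
            simp only at this
            simp only [add_right_comm x (b - a) z, this]) j
        rw [hq]
        simp only [hqe]
        rw [← hq']
        exact integral_sq_mono le_rfl (by linarith) (by linarith [M.left_lt_right j]) hc4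
      gcongr
    have hL := hbound _ _ (D j) (F j) (hD0 j) (hF0 j) hLsq hfl
    rw [M.cellForm_add_integral hw, hφ2, M.avgLeft_eq v, hval, hval, M.apply_right_prev hper]
    simp only [eval_zero, mul_zero, intervalIntegral.integral_zero, sub_self, zero_mul, sub_zero,
      add_zero, zero_add]
    refine (abs_sub _ _).trans ?_
    rw [inRight, inLeft]
    linarith
  rw [form, ← Finset.sum_add_distrib]
  refine (Finset.abs_sum_le_sum_abs _ _).trans ((Finset.sum_le_sum fun j _ => hcell j).trans ?_)
  rw [← Finset.mul_sum]
  have hsum := Real.sum_sqrt_mul_sqrt_le Finset.univ hD0 hF0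
  have hDsum : ∑ j, D j = 5 * ∫ x in a..b, iteratedDeriv 4 w x ^ 2 :=
    hM.sum_integral_patch (by fun_prop) hper4
  rw [hDsum, Real.sqrt_mul (by norm_num)] at hsum
  have hnum : 2 * √2 * √5 ≤ 7 := by
    have : √2 * √5 ≤ 7 / 2 := by
      rw [← Real.sqrt_mul (by norm_num)]
      exact Real.sqrt_le_iff.2 ⟨by norm_num, by norm_num⟩
    linarith
  have hs : 0 ≤ sobolevSeminorm a b 4 w := Real.sqrt_nonneg _
  calc 2 * √2 * h ^ 2 * ∑ j, √(D j) * √(F j)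
      ≤ 2 * √2 * h ^ 2 * (√5 * sobolevSeminorm a b 4 w * M.norm φ) := by
        gcongr
        exact hsum
    _ = (2 * √2 * √5) * (h ^ 2 * sobolevSeminorm a b 4 w * M.norm φ) := by ring
    _ ≤ 7 * (h ^ 2 * sobolevSeminorm a b 4 w * M.norm φ) :=
        mul_le_mul_of_nonneg_right hnum
          (mul_nonneg (mul_nonneg (by positivity) hs) (M.norm_nonneg φ))
    _ = _ := by ring

theorem IsUniform.isQuasiProjection {M : Mesh a b} (hab : a < b) (hM : M.IsUniform) :
    IsQuasiProjection M 1 7 M.linearQuasiProjection where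
  mem w := M.mem_dgSpace.2 fun j => linearPoly_mem _ _ _ _
  l2Dist_le w hw hper := hM.l2Dist_linearQuasiProjection_le hab hw hper
  abs_form_add_le w hw hper φ hφ := hM.abs_form_linearQuasiProjection_add_le hab hw hper hφ
  commutes j x := by
    set l := M.left j
    set r := M.right j
    set h := M.meshSize
    set θ := (x - l) / (r - l)
    have h1 := (((commutesWithTimeDeriv_eval l).mul_const (1 - θ)).add
      ((commutesWithTimeDeriv_nodalCorrection h l).mul_const (θ - 1))).add
      (((commutesWithTimeDeriv_eval r).mul_const θ).add
      ((commutesWithTimeDeriv_nodalCorrection h r).mul_const θ))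
    convert h1 using 2
    rw [linearQuasiProjection, eval_linearPoly]
    ring

end Mesh

/-! ### Seminorms of periodic functions -/

theorem iteratedDeriv_iteratedDeriv (m n : ℕ) (w : ℝ → ℝ) :
    iteratedDeriv m (iteratedDeriv n w) = iteratedDeriv (m + n) w := by
  simp only [iteratedDeriv_eq_iterate, Function.iterate_add_apply]

theorem sobolevSeminorm_neg_iteratedDeriv (a b : ℝ) (m n : ℕ) (w : ℝ → ℝ) :
    sobolevSeminorm a b m (fun x => -iteratedDeriv n w x) = sobolevSeminorm a b (m + n) w := by
  have : ∀ x, iteratedDeriv m (fun x => -iteratedDeriv n w x) x = -iteratedDeriv (m + n) w x := by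
    intro x
    rw [← iteratedDeriv_iteratedDeriv, ← iteratedDeriv_neg]
    rfl
  simp only [sobolevSeminorm, this, neg_sq]

theorem periodic_iteratedDeriv {w : ℝ → ℝ} {c : ℝ} (hw : Function.Periodic w c) (n : ℕ) :
    Function.Periodic (iteratedDeriv n w) c := by
  induction n with
  | zero => simpa using hw
  | succ n ih =>
    rw [iteratedDeriv_succ]
    exact periodic_deriv ih

theorem contDiff_iteratedDeriv {w : ℝ → ℝ} (hw : ContDiff ℝ (⊤ : ℕ∞) w) (n : ℕ) :
    ContDiff ℝ (⊤ : ℕ∞) (iteratedDeriv n w) := by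
  induction n with
  | zero => simpa using hw
  | succ n ih =>
    rw [iteratedDeriv_succ]
    exact (contDiff_infty_iff_deriv.1 ih).2

theorem sobolevSeminorm_nonneg (a b : ℝ) (m : ℕ) (w : ℝ → ℝ) : 0 ≤ sobolevSeminorm a b m w :=
  Real.sqrt_nonneg _

/-- A derivative of a periodic function has mean zero over a period, so the Poincaré inequality
applies. Used twice, this controls |u|_{k+1} by |u|_{k+3}. -/
theorem sobolevSeminorm_succ_le {a b : ℝ} (hab : a < b) {w : ℝ → ℝ}
    (hw : ContDiff ℝ (⊤ : ℕ∞) w) (hper : Function.Periodic w (b - a)) (n : ℕ) :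
    sobolevSeminorm a b (n + 1) w ≤ (b - a) * sobolevSeminorm a b (n + 2) w := by
  have h0 : ∫ x in a..b, iteratedDeriv (n + 1) w x = 0 := by
    rw [iteratedDeriv_succ, integral_deriv_eq_sub
      (fun x _ => (contDiff_iteratedDeriv hw n).differentiable (by simp) x)
      ((contDiff_infty_iff_deriv.1 (contDiff_iteratedDeriv hw n)).2.continuous.intervalIntegrable
        _ _), sub_eq_zero]
    have := periodic_iteratedDeriv hper n a
    rwa [add_sub_cancel] at this
  have h1 := integral_sq_le_of_integral_eq_zero hab
    ((contDiff_iteratedDeriv hw (n + 1)).of_le (by exact_mod_cast le_top)) h0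
  rw [← iteratedDeriv_succ] at h1
  rw [sobolevSeminorm, sobolevSeminorm]
  refine (Real.sqrt_le_sqrt h1).trans (le_of_eq ?_)
  rw [Real.sqrt_mul (sq_nonneg _), Real.sqrt_sq (sub_nonneg.2 hab.le)]

/-! ### Time dependent polynomials -/

theorem exists_nodal_basis (k : ℕ) : ∃ B : Fin (k + 1) → ℝ[X],
    ∀ p ∈ degreeLE ℝ (k : WithBot ℕ), ∀ x, p.eval x = ∑ i : Fin (k + 1), p.eval (i : ℝ) * (B i).eval x := by
  refine ⟨Lagrange.basis Finset.univ fun i : Fin (k + 1) => (i : ℝ), fun p hp x => ?_⟩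
  have hinj : Set.InjOn (fun i : Fin (k + 1) => (i : ℝ)) (Finset.univ : Finset (Fin (k + 1))) :=
    fun i _ j _ h => Fin.ext (Nat.cast_injective (R := ℝ) h)
  have hdeg : p.degree < (Finset.univ : Finset (Fin (k + 1))).card := by
    rw [Finset.card_univ, Fintype.card_fin]
    exact (mem_degreeLE.1 hp).trans_lt (by exact_mod_cast Nat.lt_succ_self k)
  conv_lhs => rw [Lagrange.eq_interpolate hinj hdeg]
  simp [Lagrange.interpolate_apply, eval_finsetSum]

theorem integral_sq_sum {n : ℕ} (B : Fin n → ℝ[X]) (c : Fin n → ℝ) (d : Fin n → ℝ) (l r : ℝ) :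
    ∫ x in l..r, (∑ i, c i * (B i).eval x) * ∑ i, d i * (B i).eval x
      = ∑ i, ∑ i', c i * d i' * ∫ x in l..r, (B i).eval x * (B i').eval x := by
  have h : ∀ x, (∑ i, c i * (B i).eval x) * ∑ i, d i * (B i).eval x
      = ∑ i, ∑ i', c i * d i' * ((B i).eval x * (B i').eval x) := by
    intro x
    rw [Finset.sum_mul_sum]
    exact Finset.sum_congr rfl fun i _ => Finset.sum_congr rfl fun i' _ => by ring
  simp only [h]
  rw [intervalIntegral.integral_finsetSum
    fun i _ => Continuous.intervalIntegrable (by fun_prop) _ _]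
  refine Finset.sum_congr rfl fun i _ => ?_
  rw [intervalIntegral.integral_finsetSum
    fun i _ => Continuous.intervalIntegrable (by fun_prop) _ _]
  simp

theorem continuousOn_integral_eval_sq {k : ℕ} {S : Set ℝ} {p : ℝ → ℝ[X]}
    (hmem : ∀ s ∈ S, p s ∈ degreeLE ℝ (k : WithBot ℕ))
    (hcont : ∀ x, ContinuousOn (fun s => (p s).eval x) S) (l r : ℝ) :
    ContinuousOn (fun s => ∫ x in l..r, (p s).eval x ^ 2) S := by
  obtain ⟨B, hB⟩ := exists_nodal_basis k
  have h1 : ContinuousOn (fun s => ∑ i : Fin (k + 1), ∑ i' : Fin (k + 1),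
      (p s).eval (i : ℝ) * (p s).eval (i' : ℝ) *
        ∫ x in l..r, (B i).eval x * (B i').eval x) S :=
    continuousOn_finsetSum _ fun i _ => continuousOn_finsetSum _ fun i' _ =>
      ((hcont _).mul (hcont _)).mul continuousOn_const
  refine h1.congr fun s hs => ?_
  beta_reduce
  rw [← integral_sq_sum B (fun i => (p s).eval (i : ℝ))]
  simp only [← hB _ (hmem s hs), sq]

/-- Differentiability is given only pointwise in x. Interpolation at the nodes 0, …, k reduces the
integral to a quadratic form in finitely many differentiable functions of time, and shows that d is
polynomial in x. -/
theorem hasDerivAt_integral_eval_sq {k : ℕ} {S : Set ℝ} {p : ℝ → ℝ[X]}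
    (hmem : ∀ s ∈ S, p s ∈ degreeLE ℝ (k : WithBot ℕ)) {t : ℝ} (ht : S ∈ nhds t) {d : ℝ → ℝ}
    (hd : ∀ x, HasDerivAt (fun s => (p s).eval x) (d x) t) (l r : ℝ) :
    Continuous d ∧ HasDerivAt (fun s => ∫ x in l..r, (p s).eval x ^ 2)
      (2 * ∫ x in l..r, d x * (p t).eval x) t := by
  obtain ⟨B, hB⟩ := exists_nodal_basis k
  have hdB : ∀ x, d x = ∑ i : Fin (k + 1), d (i : ℝ) * (B i).eval x := by
    intro x
    have h1 : HasDerivAt (fun s => ∑ i : Fin (k + 1), (p s).eval (i : ℝ) * (B i).eval x)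
        (∑ i : Fin (k + 1), d (i : ℝ) * (B i).eval x) t :=
      HasDerivAt.fun_sum fun i _ => (hd _).mul_const _
    refine (hd x).unique (h1.congr_of_eventuallyEq ?_)
    filter_upwards [ht] with s hs using hB _ (hmem s hs) x
  refine ⟨?_, ?_⟩
  · rw [funext hdB]
    fun_prop
  · have h1 : HasDerivAt (fun s => ∑ i : Fin (k + 1), ∑ i' : Fin (k + 1),
        (p s).eval (i : ℝ) * (p s).eval (i' : ℝ) * ∫ x in l..r, (B i).eval x * (B i').eval x)
        (∑ i : Fin (k + 1), ∑ i' : Fin (k + 1),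
          (d (i : ℝ) * (p t).eval (i' : ℝ) + (p t).eval (i : ℝ) * d (i' : ℝ)) *
            ∫ x in l..r, (B i).eval x * (B i').eval x) t :=
      HasDerivAt.fun_sum fun i _ => HasDerivAt.fun_sum fun i' _ =>
        ((hd _).mul (hd _)).mul_const _
    have hpt := hmem t (mem_of_mem_nhds ht)
    have h2 : ∫ x in l..r, d x * (p t).eval x
        = ∑ i : Fin (k + 1), ∑ i' : Fin (k + 1), d (i : ℝ) * (p t).eval (i' : ℝ) *
            ∫ x in l..r, (B i).eval x * (B i').eval x := by
      rw [← integral_sq_sum B (fun i => d (i : ℝ)) fun i => (p t).eval (i : ℝ)]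
      simp only [← hB _ hpt, ← hdB]
    have h3 : ∫ x in l..r, d x * (p t).eval x
        = ∑ i : Fin (k + 1), ∑ i' : Fin (k + 1), (p t).eval (i : ℝ) * d (i' : ℝ) *
            ∫ x in l..r, (B i).eval x * (B i').eval x := by
      rw [← integral_sq_sum B (fun i => (p t).eval (i : ℝ)) fun i => d (i : ℝ)]
      simp only [← hB _ hpt, ← hdB]
      simp only [mul_comm]
    have h4 : 2 * ∫ x in l..r, d x * (p t).eval x
        = ∑ i : Fin (k + 1), ∑ i' : Fin (k + 1),
          (d (i : ℝ) * (p t).eval (i' : ℝ) + (p t).eval (i : ℝ) * d (i' : ℝ)) *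
            ∫ x in l..r, (B i).eval x * (B i').eval x := by
      rw [two_mul]
      nth_rewrite 1 [h2]
      rw [h3, ← Finset.sum_add_distrib]
      refine Finset.sum_congr rfl fun i _ => ?_
      rw [← Finset.sum_add_distrib]
      exact Finset.sum_congr rfl fun i' _ => by ring
    rw [h4]
    refine h1.congr_of_eventuallyEq ?_
    filter_upwards [ht] with s hs
    rw [← integral_sq_sum B (fun i => (p s).eval (i : ℝ))]
    simp only [← hB _ (hmem s hs), sq]

/-- The regularised root √(E + B²) is differentiable even where E = 0. As it dominates both √E and
B, its derivative is at most A + B, so no exponential factor appears. -/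
theorem sqrt_le_of_deriv_le {E E' : ℝ → ℝ} {T A B : ℝ} (hA : 0 ≤ A) (hB : 0 < B)
    (hE0 : ∀ s, 0 ≤ E s) (hE : ContinuousOn E (Icc 0 T))
    (hE' : ∀ s ∈ Ioo 0 T, HasDerivAt E (E' s) s)
    (hle : ∀ s ∈ Ioo 0 T, E' s ≤ 2 * A * √(E s) + 2 * B ^ 2) {t : ℝ} (ht : t ∈ Icc 0 T) :
    √(E t) ≤ √(E 0) + B + (A + B) * T := by
  have hpos : ∀ s, 0 < E s + B ^ 2 := fun s => by
    have := hE0 s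
    positivity
  have hanti : AntitoneOn (fun s => √(E s + B ^ 2) - (A + B) * s) (Icc 0 T) := by
    refine antitoneOn_of_hasDerivWithinAt_nonpos (convex_Icc 0 T)
      (f' := fun s => E' s / (2 * √(E s + B ^ 2)) - (A + B)) ?_ ?_ ?_
    · exact ((hE.add continuousOn_const).sqrt).sub (by fun_prop)
    · intro s hs
      rw [interior_Icc] at hs
      have h1 := (((hE' s hs).add_const (B ^ 2)).sqrt (hpos s).ne').sub
        ((hasDerivAt_id s).const_mul (A + B))
      rw [mul_one] at h1
      exact h1.hasDerivWithinAt
    · intro s hs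
      rw [interior_Icc] at hs
      have h1 : √(E s) ≤ √(E s + B ^ 2) := Real.sqrt_le_sqrt (by nlinarith)
      have h2 : B ≤ √(E s + B ^ 2) := Real.le_sqrt_of_sq_le (by linarith [hE0 s])
      have h3 := Real.sqrt_pos.2 (hpos s)
      rw [sub_nonpos, div_le_iff₀ (by positivity)]
      nlinarith [hle s hs, mul_le_mul_of_nonneg_left h1 hA, mul_le_mul_of_nonneg_left h2 hB.le]
  have h1 := hanti (left_mem_Icc.2 (ht.1.trans ht.2)) ht ht.1
  simp only [mul_zero, sub_zero] at h1
  have h2 : √(E 0 + B ^ 2) ≤ √(E 0) + B := by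
    refine Real.sqrt_le_iff.2 ⟨by positivity, ?_⟩
    nlinarith [Real.sq_sqrt (hE0 0), mul_nonneg (Real.sqrt_nonneg (E 0)) hB.le]
  have h3 : √(E t) ≤ √(E t + B ^ 2) := Real.sqrt_le_sqrt (by nlinarith)
  have h4 : (A + B) * t ≤ (A + B) * T := mul_le_mul_of_nonneg_left ht.2 (by positivity)
  linarith

/-! ### The error estimate -/

theorem IsQuasiProjection.mono {a b : ℝ} (hab : a < b) {M : Mesh a b} {k : ℕ} {K K' : ℝ}
    {P : (ℝ → ℝ) → Fin M.N → ℝ[X]} (hP : IsQuasiProjection M k K P) (h : K ≤ K') :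
    IsQuasiProjection M k K' P := by
  have hh := M.meshSize_pos hab
  refine ⟨hP.mem, fun w hw hper => (hP.l2Dist_le w hw hper).trans ?_, fun w hw hper φ hφ =>
    (hP.abs_form_add_le w hw hper φ hφ).trans ?_, hP.commutes⟩
  · have := sobolevSeminorm_nonneg a b (k + 1) w
    gcongr
  · have := sobolevSeminorm_nonneg a b (k + 3) w
    have := M.norm_nonneg φ
    gcongr

theorem exists_isQuasiProjection {a b : ℝ} (hab : a < b) (M : Mesh a b) {k : ℕ} (hk : 1 ≤ k)
    (hM : k = 1 → M.IsUniform) : ∃ P, IsQuasiProjection M k 7 P := by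
  match k, hk, hM with
  | 1, _, hM => exact ⟨_, (hM rfl).isQuasiProjection hab⟩
  | m + 2, _, _ =>
    obtain ⟨P, hP⟩ := exists_isQuasiProjection_of_two_le hab M m
    exact ⟨P, hP.mono hab (by norm_num)⟩

section ErrorEstimate

variable {a b T : ℝ} {u₀ : ℝ → ℝ} {u : ℝ → ℝ → ℝ} {M : Mesh a b} {k : ℕ}
  {uh qh : ℝ → Fin M.N → ℝ[X]} {K M₁ M₂ : ℝ} {P : (ℝ → ℝ) → Fin M.N → ℝ[X]}

/-- The L² projection makes u₀ - u_h(0) orthogonal to ξ, so ‖ξ‖² is the inner product of u₀ - P u₀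
with ξ. -/
theorem IsQuasiProjection.norm_initial_le (hP : IsQuasiProjection M k K P)
    (huh : M.IsSemiDiscreteSolution k T u₀ uh qh) (hu₀ : Continuous u₀) :
    M.norm (uh 0 - P u₀) ≤ M.l2Dist (P u₀) u₀ := by
  set ξ := uh 0 - P u₀ with hξ
  have hmem : ξ ∈ M.dgSpace k := Submodule.sub_mem _ huh.initial.1 (hP.mem _)
  have h1 : M.norm ξ ^ 2
      = -∑ j, ∫ x in (M.left j)..(M.right j), ((P u₀ j).eval x - u₀ x) * (ξ j).eval x := by
    rw [M.norm_sq, ← Finset.sum_neg_distrib]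
    refine Finset.sum_congr rfl fun j _ => ?_
    have h2 := huh.initial.2 (ξ j) (M.mem_dgSpace.1 hmem j) j
    rw [← sub_zero (-_), ← h2, ← intervalIntegral.integral_neg, ← intervalIntegral.integral_sub]
    · congr 1
      ext x
      simp only [hξ, Pi.sub_apply, eval_sub]
      ring
    all_goals exact Continuous.intervalIntegrable (by fun_prop) _ _
  have h3 := (neg_le_abs _).trans (M.abs_sum_integral_sub_mul_le (P u₀) ξ hu₀)
  rw [← h1] at h3
  have h4 := M.norm_nonneg ξ
  have h5 := M.l2Dist_nonneg (P u₀) u₀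
  by_contra! h
  nlinarith

/-- Here d is the time derivative of ξ. The regularity assumptions are used twice each: |q|_{k+1} =
|u|_{k+3} is bounded by M₂, and |q|_{k+3} = |u_t|_{k+1} by M₁. -/
theorem IsQuasiProjection.energy_le (hab : a < b) (hK : 0 ≤ K) (hP : IsQuasiProjection M k K P)
    (hu : IsSmoothPeriodicSolution a b T u₀ u)
    (huh : M.IsSemiDiscreteSolution k T u₀ uh qh) {t : ℝ} (ht : t ∈ Ioo 0 T)
    (h₁ : sobolevSeminorm a b (k + 1) (timeDeriv T u t) ≤ M₁)
    (h₂ : sobolevSeminorm a b (k + 3) (fun x => u x t) ≤ M₂)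
    {d : Fin M.N → ℝ → ℝ} (hdc : ∀ j, Continuous (d j))
    (hd : ∀ j x, d j x = derivWithin (fun s => (uh s j).eval x) (Icc 0 T) t
      - (P (timeDeriv T u t) j).eval x) :
    2 * ∑ j, ∫ x in (M.left j)..(M.right j), d j x * ((uh t - P fun x => u x t) j).eval x
      ≤ 2 * (2 * K * M₁ * M.meshSize ^ (k + 1)) * M.norm (uh t - P fun x => u x t)
        + 2 * (2 * K * M₂ * M.meshSize ^ (k + 1)) ^ 2 := by
  have hh := M.meshSize_pos hab
  have htc : t ∈ Icc 0 T := Ioo_subset_Icc_self ht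
  set w : ℝ → ℝ := fun x => u x t with hwdef
  have hw : ContDiff ℝ (⊤ : ℕ∞) w := contDiff_slice hu.smooth htc
  have hper : Function.Periodic w (b - a) := hu.periodic t htc
  set q : ℝ → ℝ := fun x => -iteratedDeriv 2 w x with hq
  have hqs : ContDiff ℝ (⊤ : ℕ∞) q := (contDiff_iteratedDeriv hw 2).neg
  have hqper : Function.Periodic q (b - a) := fun x => by
    simp only [hq, periodic_iteratedDeriv hper 2 x]
  have hut : timeDeriv T u t = fun x => -iteratedDeriv 4 w x :=
    funext fun x => hu.pde t ⟨ht.1, ht.2.le⟩ x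
  have hq2 : iteratedDeriv 2 q = timeDeriv T u t := by
    rw [hut]
    ext x
    rw [← iteratedDeriv_iteratedDeriv 2 2, ← iteratedDeriv_neg]
    rfl
  have huts : ContDiff ℝ (⊤ : ℕ∞) (timeDeriv T u t) := by
    rw [hut]
    exact (contDiff_iteratedDeriv hw 4).neg
  have hutper : Function.Periodic (timeDeriv T u t) (b - a) := fun x => by
    simp only [hut, periodic_iteratedDeriv hper 4 x]
  have hq1 : sobolevSeminorm a b (k + 1) q ≤ M₂ := by
    rw [sobolevSeminorm_neg_iteratedDeriv]
    exact h₂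
  have hq3 : sobolevSeminorm a b (k + 3) q ≤ M₁ := by
    rw [hut, sobolevSeminorm_neg_iteratedDeriv] at h₁
    rw [sobolevSeminorm_neg_iteratedDeriv]
    exact h₁
  set ξ := uh t - P w with hξ
  set ζ := qh t - P q with hζ
  have hξm : ξ ∈ M.dgSpace k := Submodule.sub_mem _ (huh.uh_mem t htc) (hP.mem _)
  have hζm : ζ ∈ M.dgSpace k := Submodule.sub_mem _ (huh.qh_mem t htc) (hP.mem _)
  have cut := huts.continuous
  have cq := hqs.continuous
  have R1 := hP.abs_form_add_le q hqs hqper ξ hξm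
  have R2 := hP.abs_form_add_le w hw hper ζ hζm
  have S1 := M.abs_sum_integral_sub_mul_le (P (timeDeriv T u t)) ξ cut
  have S2 := M.abs_sum_integral_sub_mul_le (P q) ζ cq
  have L1 := hP.l2Dist_le _ huts hutper
  have L2 := hP.l2Dist_le _ hqs hqper
  rw [hq2] at R1
  have hξeq : ∑ j, ∫ x in (M.left j)..(M.right j), d j x * (ξ j).eval x
      = -M.form (qh t) ξ
        - (∑ j, ∫ x in (M.left j)..(M.right j),
            ((P (timeDeriv T u t) j).eval x - timeDeriv T u t x) * (ξ j).eval x)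
        - ∑ j, ∫ x in (M.left j)..(M.right j), timeDeriv T u t x * (ξ j).eval x := by
    rw [Mesh.form, ← Finset.sum_neg_distrib, ← Finset.sum_sub_distrib, ← Finset.sum_sub_distrib]
    refine Finset.sum_congr rfl fun j _ => ?_
    have hdj := hdc j
    have e1 : ∀ x, derivWithin (fun s => (uh s j).eval x) (Icc 0 T) t
        = d j x + (P (timeDeriv T u t) j).eval x := fun x => by rw [hd]; ring
    rw [← huh.eq_u t htc ξ hξm j]
    simp only [e1]
    rw [← intervalIntegral.integral_sub, ← intervalIntegral.integral_sub]
    · congr 1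
      ext x
      ring
    all_goals exact Continuous.intervalIntegrable (by fun_prop) _ _
  have hζeq : M.norm ζ ^ 2 = M.form (uh t) ζ
      - (∑ j, ∫ x in (M.left j)..(M.right j), ((P q j).eval x - q x) * (ζ j).eval x)
      + ∑ j, ∫ x in (M.left j)..(M.right j), iteratedDeriv 2 w x * (ζ j).eval x := by
    rw [M.norm_sq, Mesh.form, ← Finset.sum_sub_distrib, ← Finset.sum_add_distrib]
    refine Finset.sum_congr rfl fun j _ => ?_
    have c2 := continuous_iteratedDeriv hw 2
    rw [← huh.eq_q t htc ζ hζm j, ← intervalIntegral.integral_sub, ← intervalIntegral.integral_add]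
    · congr 1
      ext x
      simp only [hζ, hq, Pi.sub_apply, eval_sub]
      ring
    all_goals exact Continuous.intervalIntegrable (by fun_prop) _ _
  have hsymm : M.form ξ ζ = M.form ζ ξ := M.form_comm _ _
  have hfξ : M.form ξ ζ = M.form (uh t) ζ - M.form (P w) ζ := M.form_sub_left _ _ _
  have hfζ : M.form ζ ξ = M.form (qh t) ξ - M.form (P q) ξ := M.form_sub_left _ _ _
  have hξ0 := M.norm_nonneg ξ
  have hζ0 := M.norm_nonneg ζ
  have hKh : 0 ≤ K * M.meshSize ^ (k + 1) := by positivity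
  have R1' := R1.trans (mul_le_mul_of_nonneg_right (mul_le_mul_of_nonneg_left hq3 hKh) hξ0)
  have R2' := R2.trans (mul_le_mul_of_nonneg_right (mul_le_mul_of_nonneg_left h₂ hKh) hζ0)
  have S1' := S1.trans (mul_le_mul_of_nonneg_right
    (L1.trans (mul_le_mul_of_nonneg_left h₁ hKh)) hξ0)
  have S2' := S2.trans (mul_le_mul_of_nonneg_right
    (L2.trans (mul_le_mul_of_nonneg_left hq1 hKh)) hζ0)
  have b1 := abs_le.1 R1'
  have b2 := abs_le.1 R2'
  have b3 := abs_le.1 S1'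
  have b4 := abs_le.1 S2'
  set G := K * M.meshSize ^ (k + 1)
  have hfin : ∑ j, ∫ x in (M.left j)..(M.right j), d j x * (ξ j).eval x
      ≤ 2 * (G * M₁ * M.norm ξ) + 2 * (G * M₂ * M.norm ζ) - M.norm ζ ^ 2 := by
    linarith [b1.1, b2.2, b3.1, b4.1]
  have e1 : 2 * K * M₁ * M.meshSize ^ (k + 1) = 2 * (G * M₁) := by ring
  have e2 : 2 * K * M₂ * M.meshSize ^ (k + 1) = 2 * (G * M₂) := by ring
  rw [e1, e2]
  -- Young's inequality absorbs 4 G M₂‖ζ‖ into 2‖ζ‖², leaving 2(G M₂)².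
  nlinarith [sq_nonneg (G * M₂ - M.norm ζ), sq_nonneg (G * M₂)]

theorem IsQuasiProjection.error_le (hab : a < b) (hT : 0 < T) (hK : 0 ≤ K)
    (hP : IsQuasiProjection M k K P) (hu : IsSmoothPeriodicSolution a b T u₀ u)
    (h₁ : ∀ t ∈ Icc 0 T, sobolevSeminorm a b (k + 1) (timeDeriv T u t) ≤ M₁)
    (h₂ : ∀ t ∈ Icc 0 T, sobolevSeminorm a b (k + 3) (fun x => u x t) ≤ M₂)
    (huh : M.IsSemiDiscreteSolution k T u₀ uh qh) {t : ℝ} (ht : t ∈ Icc 0 T) :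
    M.l2Dist (uh t) (fun x => u x t)
      ≤ (2 * K * (b - a) ^ 2 * M₂ + (2 * K * M₂ + 1) + (2 * K * M₁ + (2 * K * M₂ + 1)) * T)
        * M.meshSize ^ (k + 1) := by
  have hh := M.meshSize_pos hab
  have h0 : (0 : ℝ) ∈ Icc 0 T := left_mem_Icc.2 hT.le
  have hM₁ : 0 ≤ M₁ := (sobolevSeminorm_nonneg _ _ _ _).trans (h₁ 0 h0)
  have hM₂ : 0 ≤ M₂ := (sobolevSeminorm_nonneg _ _ _ _).trans (h₂ 0 h0)
  set H := M.meshSize ^ (k + 1) with hH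
  have hHpos : 0 < H := by positivity
  have hsm : ∀ s ∈ Icc 0 T, ContDiff ℝ (⊤ : ℕ∞) fun x => u x s := fun s hs =>
    contDiff_slice hu.smooth hs
  have hproj : ∀ s ∈ Icc 0 T, M.l2Dist (P fun x => u x s) (fun x => u x s)
      ≤ K * (b - a) ^ 2 * M₂ * H := by
    intro s hs
    have e1 := sobolevSeminorm_succ_le hab (hsm s hs) (hu.periodic s hs) k
    have e2 := sobolevSeminorm_succ_le hab (hsm s hs) (hu.periodic s hs) (k + 1)
    have hba := sub_nonneg.2 hab.le
    have e3 : sobolevSeminorm a b (k + 1) (fun x => u x s) ≤ (b - a) * ((b - a) * M₂) :=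
      e1.trans (mul_le_mul_of_nonneg_left
        (e2.trans (mul_le_mul_of_nonneg_left (h₂ s hs) hba)) hba)
    refine (hP.l2Dist_le _ (hsm s hs) (hu.periodic s hs)).trans ?_
    refine (mul_le_mul_of_nonneg_left e3 (by positivity)).trans (le_of_eq (by ring))
  set ξ : ℝ → Fin M.N → ℝ[X] := fun s => uh s - P fun x => u x s with hξ
  have hmem : ∀ j, ∀ s ∈ Icc 0 T, ξ s j ∈ degreeLE ℝ (k : WithBot ℕ) := fun j s hs =>
    M.mem_dgSpace.1 (Submodule.sub_mem _ (huh.uh_mem s hs) (hP.mem _)) j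
  set E : ℝ → ℝ := fun s => ∑ j, ∫ x in (M.left j)..(M.right j), (ξ s j).eval x ^ 2 with hE
  have hEc : ContinuousOn E (Icc 0 T) := by
    refine continuousOn_finsetSum _ fun j _ => continuousOn_integral_eval_sq (hmem j)
      (fun x => ?_) _ _
    have c1 := (huh.differentiable j x).continuousOn
    have c2 := (hP.commutes j x T u hT hu.smooth).1
    simpa only [hξ, Pi.sub_apply, eval_sub] using c1.fun_sub c2
  set d : ℝ → Fin M.N → ℝ → ℝ := fun s j x =>
    derivWithin (fun s => (uh s j).eval x) (Icc 0 T) s - (P (timeDeriv T u s) j).eval x with hd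
  have hder : ∀ s ∈ Ioo 0 T, ∀ j, Continuous (d s j) ∧
      HasDerivAt (fun s => ∫ x in (M.left j)..(M.right j), (ξ s j).eval x ^ 2)
        (2 * ∫ x in (M.left j)..(M.right j), d s j x * (ξ s j).eval x) s := by
    intro s hs j
    refine hasDerivAt_integral_eval_sq (hmem j) (Icc_mem_nhds hs.1 hs.2) (fun x => ?_) _ _
    have c1 := ((huh.differentiable j x) s (Ioo_subset_Icc_self hs)).hasDerivWithinAt.hasDerivAt
      (Icc_mem_nhds hs.1 hs.2)
    have c2 := (hP.commutes j x T u hT hu.smooth).2 s hs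
    simpa only [hξ, Pi.sub_apply, eval_sub] using c1.fun_sub c2
  -- The summand 1 in B provides the strict positivity required by the regularisation, also when M₂
  -- = 0.
  have hmain := sqrt_le_of_deriv_le (E := E) (T := T) (A := 2 * K * M₁ * H)
    (B := (2 * K * M₂ + 1) * H)
    (E' := fun s => ∑ j, 2 * ∫ x in (M.left j)..(M.right j), d s j x * (ξ s j).eval x)
    (by positivity) (by positivity) (fun s => M.sum_integral_sq_nonneg _) hEc
    (fun s hs => HasDerivAt.fun_sum fun j _ => (hder s hs j).2)
    (fun s hs => by
      rw [← Finset.mul_sum]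
      have hs' := Ioo_subset_Icc_self hs
      refine (hP.energy_le hab hK hu huh hs (h₁ s hs') (h₂ s hs') (fun j => (hder s hs j).1)
        fun j x => rfl).trans ?_
      refine add_le_add le_rfl (mul_le_mul_of_nonneg_left ?_ zero_le_two)
      exact pow_le_pow_left₀ (by positivity) (by rw [add_mul]; linarith) 2) ht
  have hini : √(E 0) ≤ K * (b - a) ^ 2 * M₂ * H := by
    have hu₀ : (fun x => u x 0) = u₀ := funext hu.initial
    have := hproj 0 h0
    have h3 : √(E 0) = M.norm (uh 0 - P u₀) := by
      rw [← hu₀]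
      rfl
    rw [hu₀] at this
    rw [h3]
    exact (hP.norm_initial_le huh (hu₀ ▸ (hsm 0 h0).continuous)).trans this
  have hfin := M.l2Dist_le_add (uh t) (P fun x => u x t) (hsm t ht).continuous
  have hnorm : M.norm (uh t - P fun x => u x t) = √(E t) := rfl
  rw [hnorm] at hfin
  have := hproj t ht
  calc _ ≤ _ := hfin
    _ ≤ K * (b - a) ^ 2 * M₂ * H + (2 * K * M₂ + 1) * H
        + (2 * K * M₁ * H + (2 * K * M₂ + 1) * H) * T + K * (b - a) ^ 2 * M₂ * H := by linarith
    _ = _ := by ring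

end ErrorEstimate

end MixedDG

theorem mainTheorem1 (a b : ℝ) (hab : a < b) (k : ℕ) (hk : 1 ≤ k) (M₁ M₂ : ℝ) :
    ∃ C₀ C₁ : ℝ,
      ∀ (T : ℝ) (_ : 0 < T)
        (u₀ : ℝ → ℝ) (u : ℝ → ℝ → ℝ) (_ : MixedDG.IsSmoothPeriodicSolution a b T u₀ u)
        (_ : ∀ t ∈ Set.Icc 0 T,
          MixedDG.sobolevSeminorm a b (k + 1) (MixedDG.timeDeriv T u t) ≤ M₁)
        (_ : ∀ t ∈ Set.Icc 0 T, MixedDG.sobolevSeminorm a b (k + 3) (fun x => u x t) ≤ M₂)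
        (M : MixedDG.Mesh a b) (_ : k = 1 → M.IsUniform)
        (uh qh : ℝ → Fin M.N → Polynomial ℝ) (_ : M.IsSemiDiscreteSolution k T u₀ uh qh),
        ∀ t ∈ Set.Icc 0 T,
          M.l2Dist (uh t) (fun x => u x t) ≤ (C₀ + C₁ * T) * M.meshSize ^ (k + 1) := by
  -- The constants are those of `error_le` with K = 7, which serves both kinds of quasi-projection.
  -- The projection error enters twice, through the initial value and at time t.
  refine ⟨2 * 7 * (b - a) ^ 2 * M₂ + (2 * 7 * M₂ + 1), 2 * 7 * M₁ + (2 * 7 * M₂ + 1),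
    fun T hT u₀ u hu h₁ h₂ M hM uh qh huh t ht => ?_⟩
  obtain ⟨P, hP⟩ := MixedDG.exists_isQuasiProjection hab M hk hM
  exact hP.error_le hab hT (by norm_num) hu h₁ h₂ huh ht
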